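/- Let $d\ge 1$ and fix constants $0<\rho_1<\rho_2$, $h_1,h_2>0$, $g>0$. For $\kappa\in\mathbb{R}^d\setminus\{0\}$ put $$T_{j,\kappa}=\rho_j\coth(2\pi|\kappa|h_j)\ (j=1,2),\qquad \omega_\kappa=\sqrt{\frac{2\pi|\kappa|(\rho_2-\rho_1)g}{T_{1,\kappa}+T_{2,\kappa}}},\qquad \omega_{\kappa,\varepsilon}=\omega_\kappa+i\varepsilon .$$ Let $\varepsilon\ge 0$, $T>0$, $1\le p\le\infty$, $f\in L^2(\mathbb{R}^d)=L^2(\mathbb{R}^d;\mathbb{C})$ with Fourier transform $\hat f$ (the $L^2$ extension of $\hat f_\kappa=\int_{\mathbb{R}^d} f(x)e^{-2\pi i\kappa\cdot x}\,dx$), and $U\in L^p(0,T;\mathbb{R}^d)$. Put $X(t)=\int_0^tU(s)\,ds$ and $$\hat g_\kappa(t)=\frac{2\pi\rho_1\, i\,\kappa\cdot U(t)\,e^{-2\pi i\kappa\cdot X(t)}\hat f_\kappa}{\sinh(2\pi|\kappa|h_1)\,(T_{1,\kappa}+T_{2,\kappa})}.$$ Let $D(A_\varepsilon)=\{b\in L^2(\mathbb{R}^d):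 (i\omega_{\kappa,\varepsilon}b_\kappa)_\kappa\in L^2(\mathbb{R}^d)\}$, with the norm $\left(\int_{\mathbb{R}^d}(1+\omega_\kappa^2+\varepsilon^2)|b_\kappa|^2\,d\kappa\right)^{1/2}$. Then for every $\mu_0\in D(A_\varepsilon)$ there is a unique $\mu\in C^0([0,T];D(A_\varepsilon))\cap W^{1,p}(0,T;L^2(\mathbb{R}^d))$ with $\mu(0)=\mu_0$ whose weak time derivative satisfies $$\frac{d\mu_\kappa}{dt}(t)=i\omega_{\kappa,\varepsilon}\,\mu_\kappa(t)-\hat g_\kappa(t)\qquad\text{in }L^2(\mathbb{R}^d)\text{ for almost every }t\in(0,T).$$ Moreover, $\mu$ is given by Duhamel's formula: for every $t\in[0,T]$ and almost every $\kappa\in\mathbb{R}^d$, $$\mu_\kappa(t)=\mu_{0,\kappa}\,e^{i\omega_{\kappa,\varepsilon}t}-\int_0^te^{i\omega_{\kappa,\varepsilon}(t-\tau)}\hat g_\kappa(\tau)\,d\tau ,$$ where the integral converges absolutely. -/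

import Mathlib

open MeasureTheory Set Filter Topology FourierTransform

noncomputable section

namespace DeadWater

/-- Physical constants of the two-layer fluid: densities `0 < ρ₁ < ρ₂`, thicknesses `h₁, h₂ > 0`
of the upper and of the lower layer, and the acceleration of gravity `grav > 0`. -/
structure Fluid where
  ρ₁ : ℝ
  ρ₂ : ℝ
  h₁ : ℝ
  h₂ : ℝ
  grav : ℝ
  ρ₁_pos : 0 < ρ₁
  ρ₁_lt_ρ₂ : ρ₁ < ρ₂
  h₁_pos : 0 < h₁
  h₂_pos : 0 < h₂
  grav_pos : 0 < grav

/-- Physical space and frequency space `ℝ^d`, with the Euclidean norm. -/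
abbrev Space (d : ℕ) : Type := EuclideanSpace ℝ (Fin d)

/-- The Hilbert space `L²(ℝ^d; ℂ)`. -/
abbrev L2 (d : ℕ) : Type := Lp ℂ 2 (volume : Measure (Space d))

/-- Hyperbolic cotangent. -/
def coth (x : ℝ) : ℝ := Real.cosh x / Real.sinh x

variable {d : ℕ}

/-- `T_{1,κ} = ρ₁ coth(2π|κ|h₁)`. -/
def T₁ (P : Fluid) (κ : Space d) : ℝ := P.ρ₁ * coth (2 * Real.pi * ‖κ‖ * P.h₁)

/-- `T_{2,κ} = ρ₂ coth(2π|κ|h₂)`. -/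
def T₂ (P : Fluid) (κ : Space d) : ℝ := P.ρ₂ * coth (2 * Real.pi * ‖κ‖ * P.h₂)

/-- The dispersion relation `ω_κ`. -/
def omega (P : Fluid) (κ : Space d) : ℝ :=
  Real.sqrt (2 * Real.pi * ‖κ‖ * (P.ρ₂ - P.ρ₁) * P.grav / (T₁ P κ + T₂ P κ))

/-- The damped dispersion relation `ω_{κ,ε} = ω_κ + iε`. -/
def omegaEps (P : Fluid) (ε : ℝ) (κ : Space d) : ℂ :=
  (omega P κ : ℂ) + Complex.I * (ε : ℂ)

/-- The position `X(t) = ∫₀ᵗ U(s) ds` of a ship with velocity `U`. -/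
def position (U : ℝ → Space d) (t : ℝ) : Space d := ∫ s in (0 : ℝ)..t, U s

/-- The source term `ĝ_κ(t)`, where `f̂ = 𝓕 f` is the Fourier transform on `L²(ℝ^d)` (Plancherel
extension of `ξ ↦ ∫ ξ(x) exp(-2πi κ·x) dx`). -/
def source (P : Fluid) (f : L2 d) (U : ℝ → Space d) (t : ℝ) (κ : Space d) : ℂ :=
  2 * (Real.pi : ℂ) * (P.ρ₁ : ℂ) * Complex.I * ((inner ℝ κ (U t) : ℝ) : ℂ)
      * Complex.exp (-2 * (Real.pi : ℂ) * Complex.I * ((inner ℝ κ (position U t) : ℝ) : ℂ))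
      * (𝓕 f : L2 d) κ
    / ((Real.sinh (2 * Real.pi * ‖κ‖ * P.h₁) * (T₁ P κ + T₂ P κ) : ℝ) : ℂ)

/-- The domain `D(A_ε) = {b ∈ L² | A_ε b ∈ L²}` of the multiplication operator
`(A_ε b)_κ = i ω_{κ,ε} b_κ`. -/
def domain (P : Fluid) (ε : ℝ) : Set (L2 d) :=
  {b | MemLp (fun κ => Complex.I * omegaEps P ε κ * b κ) 2 (volume : Measure (Space d))}

/-- The Hilbertian norm `(∫ (1 + ω_κ² + ε²) |b_κ|² dκ)^{1/2}` of `D(A_ε)`; the integral is finite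
for `b ∈ D(A_ε)`. -/
def domainNorm (P : Fluid) (ε : ℝ) (b : L2 d) : ℝ :=
  Real.sqrt (∫ κ, (1 + omega P κ ^ 2 + ε ^ 2) * ‖b κ‖ ^ 2)

/-- `μ ∈ C⁰([0,T]; D(A_ε))`, for the norm of `D(A_ε)`. -/
def ContinuousInDomain (P : Fluid) (ε T : ℝ) (μ : ℝ → L2 d) : Prop :=
  (∀ t ∈ Icc 0 T, μ t ∈ domain P ε) ∧
    ∀ t₀ ∈ Icc 0 T,
      Tendsto (fun t => domainNorm P ε (μ t - μ t₀)) (𝓝[Icc 0 T] t₀) (𝓝 0)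

/-- `v` is the weak (distributional) derivative of `u` on `(0,T)`, for functions with values in a
Banach space. -/
def HasWeakDeriv {E : Type*} [NormedAddCommGroup E] [NormedSpace ℝ E]
    (T : ℝ) (u v : ℝ → E) : Prop :=
  LocallyIntegrableOn u (Ioo 0 T) ∧ LocallyIntegrableOn v (Ioo 0 T) ∧
    ∀ φ : ℝ → ℝ, ContDiff ℝ (⊤ : ℕ∞) φ → HasCompactSupport φ → tsupport φ ⊆ Ioo 0 T →
      ∫ t in Ioo 0 T, deriv φ t • u t = -∫ t in Ioo 0 T, φ t • v t

/-- `u ∈ W^{1,p}(0,T; E)`. -/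
def MemW1p {E : Type*} [NormedAddCommGroup E] [NormedSpace ℝ E]
    (p : ENNReal) (T : ℝ) (u : ℝ → E) : Prop :=
  MemLp u p (volume.restrict (Ioo 0 T)) ∧
    ∃ v : ℝ → E, MemLp v p (volume.restrict (Ioo 0 T)) ∧ HasWeakDeriv T u v

/-- `μ` solves `dμ/dt = i ω_{κ,ε} μ - ĝ(t)` on `(0,T)`: its weak derivative satisfies the equation
in `L²(ℝ^d)` for almost every time. -/
def SolvesEquation (P : Fluid) (ε T : ℝ) (f : L2 d) (U : ℝ → Space d) (μ : ℝ → L2 d) : Prop :=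
  ∃ v : ℝ → L2 d, HasWeakDeriv T μ v ∧
    ∀ᵐ t ∂(volume.restrict (Ioo 0 T)), ∀ᵐ κ ∂(volume : Measure (Space d)),
      v t κ = Complex.I * omegaEps P ε κ * μ t κ - source P f U t κ

/-- `μ` is a strong solution on `[0,T]` with initial datum `μ₀`, in the class
`C⁰([0,T]; D(A_ε)) ∩ W^{1,p}(0,T; L²(ℝ^d))`. Only the values of `μ` on `[0,T]` matter. -/
structure IsStrongSolution (P : Fluid) (ε T : ℝ) (p : ENNReal) (f : L2 d) (U : ℝ → Space d)
    (μ₀ : L2 d) (μ : ℝ → L2 d) : Prop where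
  continuous : ContinuousInDomain P ε T μ
  sobolev : MemW1p p T μ
  equation : SolvesEquation P ε T f U μ
  initial : μ 0 = μ₀

/-- Duhamel's formula on `[0,T]`:
`μ_κ(t) = μ_{0,κ} e^{iω_{κ,ε}t} - ∫₀ᵗ e^{iω_{κ,ε}(t-τ)} ĝ_κ(τ) dτ`, the integral being
absolutely convergent. -/
def Duhamel (P : Fluid) (ε T : ℝ) (f : L2 d) (U : ℝ → Space d)
    (μ₀ : L2 d) (μ : ℝ → L2 d) : Prop :=
  ∀ t ∈ Icc 0 T, ∀ᵐ κ ∂(volume : Measure (Space d)),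
    IntervalIntegrable
        (fun τ => Complex.exp (Complex.I * omegaEps P ε κ * ((t - τ : ℝ) : ℂ)) * source P f U τ κ)
        volume 0 t ∧
      μ t κ = μ₀ κ * Complex.exp (Complex.I * omegaEps P ε κ * (t : ℂ))
        - ∫ τ in (0 : ℝ)..t,
            Complex.exp (Complex.I * omegaEps P ε κ * ((t - τ : ℝ) : ℂ)) * source P f U τ κ

end DeadWater

end

/-! At a fixed frequency the equation is a scalar linear ODE, solved by variation of constants:
$\mu_\kappa(t)=e^{i\omega_{\kappa,\varepsilon}t}\bigl(\mu_{0,\kappa}-\int_0^te^{-i\omega_{\kappa,\varepsilon}\tau}\hat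
g_\kappa(\tau)\,d\tau\bigr)$. The work is to turn this family of scalar functions into one function
with values in $L^2$ and in $D(A_\varepsilon)$.

Existence rests on one majorant. The source satisfies $|\hat g_\kappa(t)|\le|U(t)|K(\kappa)|\hat
f_\kappa|$, where $K$ (`sourceKernel`) is at most $2\pi|\kappa|/\cosh(2\pi|\kappa|h_1)$, while the
weight of $D(A_\varepsilon)$ grows at most linearly in $|\kappa|$. Hence weight times $K$ is bounded
(`exists_weight_mul_sourceKernel_le`), and the source lies in $D(A_\varepsilon)$ for every $f\in
L^2$. As $\varepsilon\ge0$, the forward propagator is a contraction, so `duhamelBound` dominates the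
formula on all of $[0,T]$. Dominated convergence gives continuity in $D(A_\varepsilon)$. Since $U$
is only $L^p$ in time, the equation is tested against $\varphi$ frequency by frequency
(`integral_deriv_mul_duhamelSol`), and `coeFn_integral_L2` transfers the result to the $L^2$-valued
integral.

For uniqueness, the difference $\delta$ of two solutions is the primitive of $A_\varepsilon\delta$
(`HasWeakDeriv.eq_add_integral`). The operator $A_\varepsilon$ may be unbounded, but it commutes
with the cutoff to frequencies of weight at most $n$ and is bounded there. Uniqueness for bounded
linear ODEs kills each cutoff of $\delta$, and $n$ is arbitrary. -/

noncomputable section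

namespace DeadWater

/-! ### Integration by parts for primitives of integrable functions -/

section Calculus

variable {𝕜 E : Type*} [RCLike 𝕜] [NormedAddCommGroup E] [NormedSpace ℝ E] [NormedSpace 𝕜 E]
  [CompleteSpace E]

/-- Integration by parts against the primitive of an integrable function. -/
theorem integral_deriv_smul_primitive {T : ℝ} {Φ Φ' : ℝ → 𝕜} {y : ℝ → E}
    (hΦ : ∀ t, HasDerivAt Φ (Φ' t) t) (hΦ' : Continuous Φ')
    (hy : IntegrableOn y (Ioc 0 T)) :
    ∫ t in Ioc 0 T, Φ' t • (∫ s in (0 : ℝ)..t, y s) =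
      ∫ s in Ioc 0 T, (Φ T - Φ s) • y s := by
  set ρ : Measure ℝ := volume.restrict (Ioc 0 T)
  -- Fubini on the triangle `s ≤ t`: integrating `Φ'` over `[s, T]` first produces `Φ T - Φ s`.
  set F : ℝ × ℝ → E := indicator {q : ℝ × ℝ | q.2 ≤ q.1} (fun q => Φ' q.1 • y q.2)
  have hΦi : Integrable Φ' ρ :=
    (hΦ'.integrableOn_Icc (a := 0) (b := T)).mono_set Ioc_subset_Icc_self
  have hF : Integrable F (ρ.prod ρ) :=
    (hΦi.smul_prod hy).indicator (measurableSet_le measurable_snd measurable_fst)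
  have h1 : ∀ t ∈ Ioc 0 T, Φ' t • (∫ s in (0 : ℝ)..t, y s) = ∫ s, F (t, s) ∂ρ := by
    intro t ht
    have : (fun s => F (t, s)) = indicator (Iic t) (fun s => Φ' t • y s) := by
      ext s; simp [F, indicator]
    rw [this, integral_indicator measurableSet_Iic, Measure.restrict_restrict measurableSet_Iic,
      integral_smul, intervalIntegral.integral_of_le ht.1.le]
    congr 3
    ext s; simp only [mem_Ioc, mem_inter_iff, mem_Iic]
    exact ⟨fun h => ⟨h.2, h.1, h.2.trans ht.2⟩, fun h => ⟨h.2.1, h.1⟩⟩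
  have h2 : ∀ s ∈ Ioc 0 T, ∫ t, F (t, s) ∂ρ = (Φ T - Φ s) • y s := by
    intro s hs
    have : (fun t => F (t, s)) = indicator (Ici s) (fun t => Φ' t • y s) := by
      ext t; simp [F, indicator]
    rw [this, integral_indicator measurableSet_Ici, Measure.restrict_restrict measurableSet_Ici,
      integral_smul_const]
    congr 1
    have : Ici s ∩ Ioc 0 T = Icc s T := by
      ext t; simp only [mem_Ioc, mem_inter_iff, mem_Ici, mem_Icc]
      exact ⟨fun h => ⟨h.1, h.2.2⟩, fun h => ⟨h.1, hs.1.trans_le h.1, h.2⟩⟩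
    rw [this, integral_Icc_eq_integral_Ioc, ← intervalIntegral.integral_of_le hs.2]
    exact intervalIntegral.integral_eq_sub_of_hasDerivAt (fun t _ => hΦ t)
      (hΦ'.intervalIntegrable _ _)
  rw [setIntegral_congr_fun measurableSet_Ioc h1, integral_integral_swap (f := fun t s => F (t, s)) hF,
    setIntegral_congr_fun measurableSet_Ioc h2]

end Calculus

/-! ### Weak derivatives of Banach-valued functions on an interval -/

section WeakDeriv

variable {E : Type*} [NormedAddCommGroup E] [NormedSpace ℝ E]

theorem integral_smul_eq_setIntegral {T : ℝ} {φ : ℝ → ℝ} (hφ : tsupport φ ⊆ Ioo 0 T)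
    (u : ℝ → E) : ∫ t, φ t • u t = ∫ t in Ioo 0 T, φ t • u t := by
  refine (setIntegral_eq_integral_of_forall_compl_eq_zero fun t ht => ?_).symm
  rw [image_eq_zero_of_notMem_tsupport fun h => ht (hφ h), zero_smul]

/-- A compactly supported multiple of a locally integrable function is integrable. -/
theorem integrableOn_smul_of_tsupport_subset {T : ℝ} {φ : ℝ → ℝ} (hφc : Continuous φ)
    (hφs : HasCompactSupport φ) (hφ : tsupport φ ⊆ Ioo 0 T) {u : ℝ → E}
    (hu : LocallyIntegrableOn u (Ioo 0 T)) : IntegrableOn (fun t => φ t • u t) (Ioo 0 T) := by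
  have h1 : IntegrableOn (fun t => φ t • u t) (tsupport φ) :=
    (hu.integrableOn_compact_subset hφ hφs).continuousOn_smul hφc.continuousOn hφs
  refine ((integrableOn_iff_integrable_of_support_subset ?_).1 h1).integrableOn
  intro t ht
  by_contra h
  exact ht (by simp [image_eq_zero_of_notMem_tsupport h])

theorem HasWeakDeriv.sub {T : ℝ} {u₁ u₂ v₁ v₂ : ℝ → E} (h₁ : HasWeakDeriv T u₁ v₁)
    (h₂ : HasWeakDeriv T u₂ v₂) : HasWeakDeriv T (u₁ - u₂) (v₁ - v₂) := by
  refine ⟨h₁.1.sub h₂.1, h₁.2.1.sub h₂.2.1, fun φ hφ hc hs => ?_⟩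
  have hd : Continuous (deriv φ) := hφ.continuous_deriv (by simp)
  have hds : tsupport (deriv φ) ⊆ Ioo 0 T := (tsupport_deriv_subset (𝕜 := ℝ)).trans hs
  simp only [Pi.sub_apply, smul_sub]
  rw [integral_sub (integrableOn_smul_of_tsupport_subset hd hc.deriv hds h₁.1)
      (integrableOn_smul_of_tsupport_subset hd hc.deriv hds h₂.1),
    integral_sub (integrableOn_smul_of_tsupport_subset hφ.continuous hc hs h₁.2.1)
      (integrableOn_smul_of_tsupport_subset hφ.continuous hc hs h₂.2.1),
    h₁.2.2 φ hφ hc hs, h₂.2.2 φ hφ hc hs]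
  abel

/-- Fundamental lemma of the calculus of variations. A strong solution carries two weak derivatives,
one in $L^p$ and one satisfying the equation; this identifies them. -/
theorem HasWeakDeriv.ae_unique [CompleteSpace E] {T : ℝ} {u v₁ v₂ : ℝ → E}
    (h₁ : HasWeakDeriv T u v₁) (h₂ : HasWeakDeriv T u v₂) :
    v₁ =ᵐ[volume.restrict (Ioo 0 T)] v₂ := by
  have h := h₁.sub h₂
  have := isOpen_Ioo.ae_eq_zero_of_integral_contDiff_smul_eq_zero h.2.1 fun φ hφ hc hs => by
    rw [integral_smul_eq_setIntegral hs, ← neg_eq_zero, ← h.2.2 φ hφ hc hs]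
    simp
  rw [EventuallyEq, ae_restrict_iff' measurableSet_Ioo]
  filter_upwards [this] with t ht hmem
  exact sub_eq_zero.1 (ht hmem)

theorem exists_Icc_of_isCompact_subset_Ioo {T : ℝ} (hT : 0 < T) {K : Set ℝ} (hK : IsCompact K)
    (h : K ⊆ Ioo 0 T) : ∃ a b, 0 < a ∧ b < T ∧ K ⊆ Icc a b := by
  rcases K.eq_empty_or_nonempty with rfl | hne
  -- For empty `K` the infimum is `0` by convention, so `0 < a` would fail; the reversed endpoints
  -- work instead.
  · exact ⟨T, 0, hT, hT, by simp⟩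
  · exact ⟨sInf K, sSup K, (h (hK.sInf_mem hne)).1, (h (hK.sSup_mem hne)).2,
      fun x hx => ⟨csInf_le hK.bddBelow hx, le_csSup hK.bddAbove hx⟩⟩

/-- A test function on `(0,T)` of zero mean has a primitive which is a test function. -/
theorem exists_primitive_of_integral_eq_zero {T : ℝ} (hT : 0 < T) {θ : ℝ → ℝ}
    (hθ : ContDiff ℝ (⊤ : ℕ∞) θ) (hc : HasCompactSupport θ) (hs : tsupport θ ⊆ Ioo 0 T)
    (h0 : ∫ t, θ t = 0) :
    ∃ φ : ℝ → ℝ, ContDiff ℝ (⊤ : ℕ∞) φ ∧ HasCompactSupport φ ∧ tsupport φ ⊆ Ioo 0 T ∧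
      deriv φ = θ := by
  obtain ⟨a, b, ha, hb, hab⟩ := exists_Icc_of_isCompact_subset_Ioo hT hc hs
  have hθ0 : ∀ t, t ∉ Icc a b → θ t = 0 := fun t ht =>
    image_eq_zero_of_notMem_tsupport fun h => ht (hab h)
  have hder : ∀ t, HasDerivAt (fun t => ∫ s in (0 : ℝ)..t, θ s) (θ t) t := fun t =>
    hθ.continuous.integral_hasStrictDerivAt 0 t |>.hasDerivAt
  have hderiv : deriv (fun t => ∫ s in (0 : ℝ)..t, θ s) = θ := funext fun t => (hder t).deriv
  have hsub : tsupport (fun t => ∫ s in (0 : ℝ)..t, θ s) ⊆ Icc a b := by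
    refine closure_minimal (fun t ht => ?_) isClosed_Icc
    by_contra hmem
    apply ht
    rw [mem_Icc, not_and_or, not_le, not_le] at hmem
    -- Left of `a` the integrand vanishes on the whole range of integration; right of `b` the range
    -- contains the support, so the primitive is the full integral, which is zero.
    rcases hmem with hta | hbt
    · refine intervalIntegral.integral_zero_ae (ae_of_all _ fun s hs' => hθ0 s fun h => ?_)
      rcases le_max_iff.1 hs'.2 with h' | h'
      · linarith [h.1]
      · linarith [h.1]
    · refine Eq.trans ?_ h0
      refine intervalIntegral.integral_eq_integral_of_support_subset fun s hs' => ?_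
      have : s ∈ Icc a b := by
        by_contra h
        exact hs' (hθ0 s h)
      exact ⟨by linarith [this.1], by linarith [this.2]⟩
  refine ⟨_, ?_, ?_, hsub.trans fun t ht => ⟨by linarith [ht.1], by linarith [ht.2]⟩, hderiv⟩
  · refine contDiff_infty_iff_deriv.2 ⟨fun t => (hder t).differentiableAt, ?_⟩
    rw [hderiv]; exact hθ
  · exact isCompact_Icc.of_isClosed_subset (isClosed_tsupport _) hsub

/-- A continuous function with an integrable weak derivative is the primitive of the latter. -/
theorem HasWeakDeriv.eq_add_integral [CompleteSpace E] {T : ℝ} (hT : 0 < T) {u v : ℝ → E}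
    (h : HasWeakDeriv T u v) (hu : ContinuousOn u (Icc 0 T)) (hv : IntegrableOn v (Ioo 0 T)) :
    ∀ t ∈ Icc 0 T, u t = u 0 + ∫ s in (0 : ℝ)..t, v s := by
  have hvc : IntegrableOn v (Ioc 0 T) := by rwa [integrableOn_Ioc_iff_integrableOn_Ioo]
  have hvi : IntegrableOn v (Icc 0 T) := by rwa [integrableOn_Icc_iff_integrableOn_Ioo]
  have hprim : ContinuousOn (fun t => ∫ s in (0 : ℝ)..t, v s) (Icc 0 T) := by
    have := intervalIntegral.continuousOn_primitive_interval (a := (0 : ℝ)) (b := T) (f := v)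
      (μ := volume) (by rwa [uIcc_of_le hT.le])
    rwa [uIcc_of_le hT.le] at this
  -- `w` has zero weak derivative (`key`), so it remains to prove that it is constant (du
  -- Bois-Reymond).
  set w : ℝ → E := fun t => u t - ∫ s in (0 : ℝ)..t, v s
  have hw : ContinuousOn w (Icc 0 T) := hu.sub hprim
  have hwi : LocallyIntegrableOn w (Ioo 0 T) :=
    (hw.mono Ioo_subset_Icc_self).locallyIntegrableOn measurableSet_Ioo
  have hpi : LocallyIntegrableOn (fun t => ∫ s in (0 : ℝ)..t, v s) (Ioo 0 T) :=
    (hprim.mono Ioo_subset_Icc_self).locallyIntegrableOn measurableSet_Ioo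
  have key : ∀ φ : ℝ → ℝ, ContDiff ℝ (⊤ : ℕ∞) φ → HasCompactSupport φ → tsupport φ ⊆ Ioo 0 T →
      ∫ t in Ioo 0 T, deriv φ t • w t = 0 := by
    intro φ hφ hc hs
    have hd : Continuous (deriv φ) := hφ.continuous_deriv (by simp)
    have hds : tsupport (deriv φ) ⊆ Ioo 0 T := (tsupport_deriv_subset (𝕜 := ℝ)).trans hs
    have hφT : φ T = 0 := image_eq_zero_of_notMem_tsupport fun h' => lt_irrefl _ (hs h').2
    have := integral_deriv_smul_primitive (𝕜 := ℝ)
      (fun t => (hφ.differentiable (by simp) t).hasDerivAt) hd hvc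
    simp only [hφT, zero_sub, neg_smul, integral_neg, integral_Ioc_eq_integral_Ioo] at this
    simp only [w, smul_sub]
    rw [integral_sub (integrableOn_smul_of_tsupport_subset hd hc.deriv hds h.1)
      (integrableOn_smul_of_tsupport_subset hd hc.deriv hds hpi), h.2.2 φ hφ hc hs, this, sub_self]
  -- A bump of integral one supported in `[T/4, 3T/4]`. Subtracting `(∫ ψ) ψ₀` from a test function
  -- `ψ` leaves zero mean, hence the derivative of a test function, to which `key` applies. The
  -- constant value of `w` is therefore its average `c` against `ψ₀`.
  let β : ContDiffBump (T / 2) := ⟨T / 8, T / 4, by positivity, by linarith⟩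
  set ψ₀ : ℝ → ℝ := β.normed volume
  have hψ₀ : ContDiff ℝ (⊤ : ℕ∞) ψ₀ := β.contDiff_normed
  have hψ₀c : HasCompactSupport ψ₀ := β.hasCompactSupport_normed
  have hψ₀s : tsupport ψ₀ ⊆ Ioo 0 T := by
    rw [β.tsupport_normed_eq, Real.closedBall_eq_Icc]
    intro t ht
    have h1 : T / 2 - T / 4 ≤ t := ht.1
    have h2 : t ≤ T / 2 + T / 4 := ht.2
    constructor <;> linarith
  have hψ₀1 : ∫ t, ψ₀ t = 1 := β.integral_normed
  set c : E := ∫ t, ψ₀ t • w t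
  have hae := isOpen_Ioo.ae_eq_zero_of_integral_contDiff_smul_eq_zero (μ := volume)
    (f := fun t => w t - c) (hwi.sub ((continuousOn_const).locallyIntegrableOn measurableSet_Ioo))
    fun ψ hψ hc hs => by
      have hiψ : Integrable ψ := hψ.continuous.integrable_of_hasCompactSupport hc
      have hiψ₀ : Integrable ψ₀ := hψ₀.continuous.integrable_of_hasCompactSupport hψ₀c
      have hts : tsupport (fun t => ψ t - (∫ s, ψ s) * ψ₀ t) ⊆ tsupport ψ ∪ tsupport ψ₀ := by
        refine closure_minimal (fun t ht => ?_)
          ((isClosed_tsupport _).union (isClosed_tsupport _))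
        by_contra hmem
        rw [mem_union, not_or] at hmem
        exact ht (by simp [image_eq_zero_of_notMem_tsupport hmem.1,
          image_eq_zero_of_notMem_tsupport hmem.2])
      obtain ⟨φ, hφ, hφc, hφs, hφd⟩ := exists_primitive_of_integral_eq_zero hT
        (θ := fun t => ψ t - (∫ s, ψ s) * ψ₀ t) (hψ.sub (contDiff_const.mul hψ₀))
        ((hc.isCompact.union hψ₀c.isCompact).of_isClosed_subset (isClosed_tsupport _) hts)
        (hts.trans (union_subset hs hψ₀s))
        (by rw [integral_sub hiψ (hiψ₀.const_mul _), integral_const_mul, hψ₀1]; simp)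
      have h0 := key φ hφ hφc hφs
      rw [hφd] at h0
      simp only [sub_smul, mul_smul] at h0
      have hi₂ : IntegrableOn (fun t => (∫ s, ψ s) • ψ₀ t • w t) (Ioo 0 T) :=
        (integrableOn_smul_of_tsupport_subset hψ₀.continuous hψ₀c hψ₀s hwi).smul _
      rw [integral_sub (integrableOn_smul_of_tsupport_subset hψ.continuous hc hs hwi) hi₂,
        integral_smul, ← integral_smul_eq_setIntegral hψ₀s] at h0
      rw [integral_smul_eq_setIntegral hs]
      simp only [smul_sub]
      rw [integral_sub (integrableOn_smul_of_tsupport_subset hψ.continuous hc hs hwi)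
        (hiψ.integrableOn.smul_const _), integral_smul_const,
        setIntegral_eq_integral_of_forall_compl_eq_zero fun t ht =>
          image_eq_zero_of_notMem_tsupport fun h => ht (hs h)]
      exact h0
  have hEq : EqOn w (fun _ => c) (Icc 0 T) := by
    refine Measure.eqOn_Icc_of_ae_eq volume hT.ne ?_ hw continuousOn_const
    rw [restrict_Ioo_eq_restrict_Icc.symm, EventuallyEq, ae_restrict_iff' measurableSet_Ioo]
    filter_upwards [hae] with t ht hmem
    exact sub_eq_zero.1 (ht hmem)
  intro t ht
  have h1 : w t = c := hEq ht
  have h2 : w 0 = c := hEq ⟨le_rfl, hT.le⟩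
  simp only [w, intervalIntegral.integral_same, sub_zero] at h1 h2
  rw [h2, ← h1]; abel

end WeakDeriv

/-! ### Square integrable representatives, dominated convergence and multipliers -/

section L2

variable {d : ℕ}

open Classical in
/-- The class of a square integrable function, and `0` for all other functions. -/
def toL2 (h : Space d → ℂ) : L2 d := if hm : MemLp h 2 volume then hm.toLp h else 0

theorem coeFn_toL2 {h : Space d → ℂ} (hm : MemLp h 2 volume) : toL2 h =ᵐ[volume] h := by
  rw [toL2, dif_pos hm]; exact hm.coeFn_toLp

theorem L2_norm_sq (b : L2 d) : ‖b‖ ^ 2 = ∫ κ, ‖b κ‖ ^ 2 := by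
  have h : (inner ℂ b b : ℂ) = ∫ κ, ((‖b κ‖ ^ 2 : ℝ) : ℂ) := by
    rw [L2.inner_def]
    refine integral_congr_ae (ae_of_all _ fun κ => ?_)
    simp only [inner_self_eq_norm_sq_to_K]; norm_cast
  rw [inner_self_eq_norm_sq_to_K, integral_complex_ofReal] at h
  refine Complex.ofReal_injective ?_
  rw [← h, Complex.ofReal_pow]; rfl

/-- No measurability of `h` is needed: the default value of `toL2` is `0`, which satisfies the
bound. -/
theorem norm_toL2_le {h : Space d → ℂ} {β : Space d → ℝ} {c : ℝ} (hc : 0 ≤ c)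
    (hβ : MemLp β 2 volume) (hle : ∀ κ, ‖h κ‖ ≤ c * β κ) :
    ‖toL2 h‖ ≤ c * ‖hβ.toLp β‖ := by
  by_cases hm : MemLp h 2 volume
  · refine Lp.norm_le_mul_norm_of_ae_le_mul ?_
    filter_upwards [coeFn_toL2 hm, hβ.coeFn_toLp] with κ h1 h2
    rw [h1, h2]
    exact (hle κ).trans (mul_le_mul_of_nonneg_left (le_abs_self _) hc)
  · rw [toL2, dif_neg hm, norm_zero]; positivity

/-- Dominated convergence in a weighted `L²` space. -/
theorem tendsto_integral_weight_mul_sq {ι : Type*} {l : Filter ι} [l.IsCountablyGenerated]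
    {H : ι → Space d → ℂ} {H₀ : Space d → ℂ} {W β : Space d → ℝ} (hW : Measurable W)
    (hβ : MemLp (fun κ => W κ * β κ) 2 volume)
    (hm : ∀ᶠ i in l, AEStronglyMeasurable (H i) volume) (hm₀ : AEStronglyMeasurable H₀ volume)
    (hb : ∀ᶠ i in l, ∀ κ, ‖H i κ‖ ≤ β κ) (hb₀ : ∀ κ, ‖H₀ κ‖ ≤ β κ)
    (hlim : ∀ κ, Tendsto (fun i => H i κ) l (𝓝 (H₀ κ))) :
    Tendsto (fun i => ∫ κ, W κ ^ 2 * ‖H i κ - H₀ κ‖ ^ 2) l (𝓝 0) := by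
  have h0 : (0 : ℝ) = ∫ _ : Space d, (0 : ℝ) := by simp
  rw [h0]
  refine tendsto_integral_filter_of_dominated_convergence (fun κ => 4 * (W κ * β κ) ^ 2)
    ?_ ?_ (hβ.integrable_sq.const_mul 4) (ae_of_all _ fun κ => ?_)
  · filter_upwards [hm] with i hi
    exact (hW.pow_const 2).aestronglyMeasurable.mul ((hi.sub hm₀).norm.pow 2)
  · filter_upwards [hb] with i hi
    refine ae_of_all _ fun κ => ?_
    have h1 : ‖H i κ - H₀ κ‖ ≤ 2 * β κ := by
      linarith [norm_sub_le (H i κ) (H₀ κ), hi κ, hb₀ κ]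
    rw [Real.norm_of_nonneg (by positivity)]
    calc W κ ^ 2 * ‖H i κ - H₀ κ‖ ^ 2 ≤ W κ ^ 2 * (2 * β κ) ^ 2 := by gcongr
      _ = _ := by ring
  · have h1 : Tendsto (fun i => H i κ - H₀ κ) l (𝓝 0) := by
      simpa using (hlim κ).sub_const (H₀ κ)
    simpa using (h1.norm.pow 2).const_mul (W κ ^ 2)

/-- Dominated convergence in `L²`. -/
theorem tendsto_toL2 {ι : Type*} {l : Filter ι} [l.IsCountablyGenerated]
    {H : ι → Space d → ℂ} {H₀ : Space d → ℂ} {β : Space d → ℝ}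
    (hβ : MemLp β 2 volume)
    (hm : ∀ᶠ i in l, AEStronglyMeasurable (H i) volume) (hm₀ : AEStronglyMeasurable H₀ volume)
    (hb : ∀ᶠ i in l, ∀ κ, ‖H i κ‖ ≤ β κ) (hb₀ : ∀ κ, ‖H₀ κ‖ ≤ β κ)
    (hlim : ∀ κ, Tendsto (fun i => H i κ) l (𝓝 (H₀ κ))) :
    Tendsto (fun i => toL2 (H i)) l (𝓝 (toL2 H₀)) := by
  have hL₀ : MemLp H₀ 2 volume := hβ.of_le hm₀ (ae_of_all _ fun κ => (hb₀ κ).trans (le_abs_self _))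
  have key := tendsto_integral_weight_mul_sq (W := fun _ => 1) measurable_const
    (by simpa using hβ) hm hm₀ hb hb₀ hlim
  rw [tendsto_iff_norm_sub_tendsto_zero]
  have h2 := (Real.continuous_sqrt.tendsto 0).comp key
  rw [Real.sqrt_zero] at h2
  refine h2.congr' ?_
  filter_upwards [hm, hb] with i hmi hbi
  have hL : MemLp (H i) 2 volume :=
    hβ.of_le hmi (ae_of_all _ fun κ => (hbi κ).trans (le_abs_self _))
  have : ∫ κ, (1 : ℝ) ^ 2 * ‖H i κ - H₀ κ‖ ^ 2 = ‖toL2 (H i) - toL2 H₀‖ ^ 2 := by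
    rw [L2_norm_sq]
    refine integral_congr_ae ?_
    filter_upwards [coeFn_toL2 hL, coeFn_toL2 hL₀, Lp.coeFn_sub (toL2 (H i)) (toL2 H₀)]
      with κ h1 h2 h3
    rw [h3, Pi.sub_apply, h1, h2]; simp
  rw [Function.comp_apply, this, Real.sqrt_sq (norm_nonneg _)]

/-- The Bochner integral of an `L²`-valued function is the pointwise integral of a jointly
measurable, dominated representative. -/
theorem coeFn_integral_L2 {α : Type*} [MeasurableSpace α] {ρ : Measure α} [SFinite ρ]
    {F : α → L2 d} {H : α → Space d → ℂ} {a : α → ℝ} {β : Space d → ℝ} (hF : Integrable F ρ)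
    (hFH : ∀ᵐ t ∂ρ, F t =ᵐ[volume] H t)
    (hH : AEStronglyMeasurable (Function.uncurry H) (ρ.prod volume))
    (ha : Integrable a ρ) (hβ : MemLp β 2 volume)
    (hb : ∀ᵐ t ∂ρ, ∀ κ, ‖H t κ‖ ≤ a t * β κ) :
    (∫ t, F t ∂ρ : L2 d) =ᵐ[volume] fun κ => ∫ t, H t κ ∂ρ := by
  -- On a set of finite measure `β` is integrable, so `H` is jointly integrable and Fubini applies.
  have hint : ∀ s : Set (Space d), volume s < ⊤ →
      Integrable (Function.uncurry H) (ρ.prod (volume.restrict s)) := by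
    intro s hs
    have : IsFiniteMeasure (volume.restrict s) := ⟨by simpa using hs⟩
    have hβs : Integrable β (volume.restrict s) := (hβ.restrict s).integrable (by norm_num)
    refine (ha.mul_prod hβs).mono' (hH.mono_measure ?_) ?_
    · exact Measure.prod_mono le_rfl Measure.restrict_le_self
    · filter_upwards [Measure.quasiMeasurePreserving_fst.ae hb] with z hz using hz z.2
  refine ae_eq_of_forall_setIntegral_eq_of_sigmaFinite
    (fun s _ hs => integrableOn_Lp_of_measure_ne_top _ (by norm_num) hs.ne)
    (fun s _ hs => (hint s hs).integral_prod_right) fun s hsm hs => ?_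
  -- Integration over `s` is the inner product with its indicator, a continuous functional, so it
  -- passes under the Bochner integral.
  rw [← L2.inner_indicatorConstLp_one (𝕜 := ℂ) hsm hs.ne, ← integral_inner hF]
  rw [← integral_integral_swap (hint s hs)]
  refine integral_congr_ae ?_
  filter_upwards [hFH] with t ht
  rw [L2.inner_indicatorConstLp_one]
  exact integral_congr_ae (ae_restrict_of_ae ht)

/-- Multiplication by a bounded measurable function, as an operator on `L²`. -/
theorem exists_mulOp {m : Space d → ℂ} (hm : Measurable m) {C : ℝ} (hC : ∀ κ, ‖m κ‖ ≤ C) :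
    ∃ Λ : L2 d →L[ℂ] L2 d, ∀ b : L2 d, Λ b =ᵐ[volume] fun κ => m κ * b κ := by
  have hmem : ∀ b : L2 d, MemLp (fun κ => m κ * b κ) 2 volume := fun b =>
    (Lp.memLp b).of_le_mul (hm.aestronglyMeasurable.mul (Lp.aestronglyMeasurable b))
      (c := C) (ae_of_all _ fun κ => by
        rw [norm_mul]; exact mul_le_mul_of_nonneg_right (hC κ) (norm_nonneg _))
  refine ⟨LinearMap.mkContinuous
    { toFun := fun b => toL2 fun κ => m κ * b κ
      map_add' := fun b c => ?_
      map_smul' := fun z b => ?_ } C fun b => ?_, fun b => coeFn_toL2 (hmem b)⟩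
  · ext1
    filter_upwards [coeFn_toL2 (hmem b), coeFn_toL2 (hmem c), coeFn_toL2 (hmem (b + c)),
      Lp.coeFn_add b c, Lp.coeFn_add (toL2 fun κ => m κ * b κ) (toL2 fun κ => m κ * c κ)]
      with κ h1 h2 h3 h4 h5
    rw [h3, h5, h4, Pi.add_apply, Pi.add_apply, h1, h2, mul_add]
  · ext1
    filter_upwards [coeFn_toL2 (hmem b), coeFn_toL2 (hmem (z • b)),
      Lp.coeFn_smul z b, Lp.coeFn_smul z (toL2 fun κ => m κ * b κ)] with κ h1 h2 h3 h4
    rw [RingHom.id_apply, h2, h4, h3, Pi.smul_apply, Pi.smul_apply, h1, smul_eq_mul, smul_eq_mul]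
    ring
  · refine Lp.norm_le_mul_norm_of_ae_le_mul ?_
    filter_upwards [coeFn_toL2 (hmem b)] with κ h1
    refine (congrArg norm h1).trans_le ?_
    rw [norm_mul]
    exact mul_le_mul_of_nonneg_right (hC κ) (norm_nonneg _)

end L2

/-! ### Bounds on the symbol and on the source term -/

section Multipliers

variable {d : ℕ}

/-- The symbol `i ω_{κ,ε}` of the operator `A_ε`. -/
def symbol (P : Fluid) (ε : ℝ) (κ : Space d) : ℂ := Complex.I * omegaEps P ε κ

/-- The weight `(1 + ω_κ² + ε²)^{1/2}` of the norm of `D(A_ε)`. -/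
def weight (P : Fluid) (ε : ℝ) (κ : Space d) : ℝ := Real.sqrt (1 + omega P κ ^ 2 + ε ^ 2)

/-- The modulus of the Fourier multiplier of the source term. -/
def sourceKernel (P : Fluid) (κ : Space d) : ℝ :=
  2 * Real.pi * P.ρ₁ * ‖κ‖ / (Real.sinh (2 * Real.pi * ‖κ‖ * P.h₁) * (T₁ P κ + T₂ P κ))

/-- The source term as a function of the velocity `u` and of the position `x` of the ship. -/
def sourceAt (P : Fluid) (f : L2 d) (u x κ : Space d) : ℂ :=
  2 * (Real.pi : ℂ) * (P.ρ₁ : ℂ) * Complex.I * ((inner ℝ κ u : ℝ) : ℂ)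
      * Complex.exp (-2 * (Real.pi : ℂ) * Complex.I * ((inner ℝ κ x : ℝ) : ℂ))
      * (𝓕 f : L2 d) κ
    / ((Real.sinh (2 * Real.pi * ‖κ‖ * P.h₁) * (T₁ P κ + T₂ P κ) : ℝ) : ℂ)

theorem source_eq_sourceAt (P : Fluid) (f : L2 d) (U : ℝ → Space d) (t : ℝ) (κ : Space d) :
    source P f U t κ = sourceAt P f (U t) (position U t) κ := rfl

theorem measurable_coth : Measurable coth := Real.measurable_cosh.div Real.measurable_sinh

theorem measurable_T₁ (P : Fluid) : Measurable (T₁ P : Space d → ℝ) :=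
  (measurable_coth.comp (by fun_prop)).const_mul _

theorem measurable_T₂ (P : Fluid) : Measurable (T₂ P : Space d → ℝ) :=
  (measurable_coth.comp (by fun_prop)).const_mul _

theorem measurable_omega (P : Fluid) : Measurable (omega P : Space d → ℝ) := by
  have := measurable_T₁ (d := d) P
  have := measurable_T₂ (d := d) P
  unfold omega
  fun_prop

theorem measurable_symbol (P : Fluid) (ε : ℝ) : Measurable (symbol P ε : Space d → ℂ) := by
  have := measurable_omega (d := d) P
  unfold symbol omegaEps
  fun_prop

theorem measurable_weight (P : Fluid) (ε : ℝ) : Measurable (weight P ε : Space d → ℝ) := by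
  have := measurable_omega (d := d) P
  unfold weight
  fun_prop

theorem measurable_sinh_mul (P : Fluid) : Measurable fun κ : Space d =>
    Real.sinh (2 * Real.pi * ‖κ‖ * P.h₁) * (T₁ P κ + T₂ P κ) := by
  have := measurable_T₁ (d := d) P
  have := measurable_T₂ (d := d) P
  fun_prop

theorem measurable_sourceKernel (P : Fluid) : Measurable (sourceKernel P : Space d → ℝ) := by
  have := measurable_sinh_mul (d := d) P
  unfold sourceKernel
  fun_prop

theorem weight_sq (P : Fluid) (ε : ℝ) (κ : Space d) :
    weight P ε κ ^ 2 = 1 + omega P κ ^ 2 + ε ^ 2 := Real.sq_sqrt (by positivity)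

theorem one_le_weight (P : Fluid) (ε : ℝ) (κ : Space d) : 1 ≤ weight P ε κ :=
  Real.one_le_sqrt.2 (by nlinarith [sq_nonneg (omega P κ), sq_nonneg ε])

theorem weight_nonneg (P : Fluid) (ε : ℝ) (κ : Space d) : 0 ≤ weight P ε κ := Real.sqrt_nonneg _

theorem norm_symbol_sq (P : Fluid) (ε : ℝ) (κ : Space d) :
    ‖symbol P ε κ‖ ^ 2 = omega P κ ^ 2 + ε ^ 2 := by
  rw [symbol, omegaEps, norm_mul, Complex.norm_I, one_mul, Complex.sq_norm, Complex.normSq_apply]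
  simp; ring

theorem norm_symbol_le_weight (P : Fluid) (ε : ℝ) (κ : Space d) :
    ‖symbol P ε κ‖ ≤ weight P ε κ :=
  Real.le_sqrt_of_sq_le (by rw [norm_symbol_sq]; linarith)

/-- Together with `one_le_weight` and `norm_symbol_le_weight`, this makes the weight comparable to
`1 + ‖symbol‖`, so that `domain` is the weighted $L^2$ space. -/
theorem weight_le_add (P : Fluid) (ε : ℝ) (κ : Space d) :
    weight P ε κ ≤ 1 + ‖symbol P ε κ‖ := by
  refine (Real.sqrt_le_left (by positivity)).2 ?_
  nlinarith [norm_symbol_sq P ε κ, norm_nonneg (symbol P ε κ)]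

theorem symbol_re (P : Fluid) (ε : ℝ) (κ : Space d) : (symbol P ε κ).re = -ε := by
  simp [symbol, omegaEps]

theorem norm_exp_symbol (P : Fluid) (ε : ℝ) (κ : Space d) (t : ℝ) :
    ‖Complex.exp (symbol P ε κ * (t : ℂ))‖ = Real.exp (-ε * t) := by
  rw [Complex.norm_exp]; simp [symbol_re]

theorem one_le_coth {x : ℝ} (hx : 0 < x) : 1 ≤ coth x := by
  rw [coth, one_le_div (Real.sinh_pos_iff.2 hx)]
  exact (Real.sinh_lt_cosh x).le

theorem coth_nonneg {x : ℝ} (hx : 0 ≤ x) : 0 ≤ coth x :=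
  div_nonneg (Real.cosh_pos x).le (Real.sinh_nonneg_iff.2 hx)

theorem T₁_nonneg (P : Fluid) (κ : Space d) : 0 ≤ T₁ P κ :=
  mul_nonneg P.ρ₁_pos.le (coth_nonneg (by have := P.h₁_pos; positivity))

theorem T₂_nonneg (P : Fluid) (κ : Space d) : 0 ≤ T₂ P κ :=
  mul_nonneg (P.ρ₁_pos.trans P.ρ₁_lt_ρ₂).le (coth_nonneg (by have := P.h₂_pos; positivity))

/-- Since $\coth\ge1$ on positive reals, $T_1+T_2\ge\rho_1$ for $\kappa\ne0$; at $\kappa=0$ both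
sides vanish. -/
theorem omega_sq_le (P : Fluid) (κ : Space d) :
    omega P κ ^ 2 ≤ 2 * Real.pi * (P.ρ₂ - P.ρ₁) * P.grav / P.ρ₁ * ‖κ‖ := by
  have hρ := P.ρ₁_pos
  have hg := P.grav_pos
  have hd : 0 < P.ρ₂ - P.ρ₁ := sub_pos.2 P.ρ₁_lt_ρ₂
  have hh := P.h₁_pos
  have hT := add_nonneg (T₁_nonneg P κ) (T₂_nonneg P κ)
  rw [omega, Real.sq_sqrt (by positivity)]
  rcases eq_or_ne κ 0 with rfl | hκ
  · simp
  · have hκ' : 0 < ‖κ‖ := norm_pos_iff.2 hκ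
    have h1 : P.ρ₁ ≤ T₁ P κ + T₂ P κ := by
      have : P.ρ₁ * 1 ≤ T₁ P κ := mul_le_mul_of_nonneg_left (one_le_coth (by positivity)) hρ.le
      linarith [T₂_nonneg P κ]
    calc 2 * Real.pi * ‖κ‖ * (P.ρ₂ - P.ρ₁) * P.grav / (T₁ P κ + T₂ P κ)
        ≤ 2 * Real.pi * ‖κ‖ * (P.ρ₂ - P.ρ₁) * P.grav / P.ρ₁ := by gcongr
      _ = _ := by ring

theorem sourceKernel_nonneg (P : Fluid) (κ : Space d) : 0 ≤ sourceKernel P κ := by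
  have hρ := P.ρ₁_pos
  have hh := P.h₁_pos
  have hT := add_nonneg (T₁_nonneg P κ) (T₂_nonneg P κ)
  have : 0 ≤ Real.sinh (2 * Real.pi * ‖κ‖ * P.h₁) := Real.sinh_nonneg_iff.2 (by positivity)
  unfold sourceKernel; positivity

/-- The product $\sinh\cdot T_1$ is exactly $\rho_1\cosh$: the singularity of $\coth$ at low
frequency compensates the zero of $\sinh$, and exponential decay remains at high frequency. -/
theorem sourceKernel_le (P : Fluid) (κ : Space d) :
    sourceKernel P κ ≤ 2 * Real.pi * ‖κ‖ / Real.cosh (2 * Real.pi * ‖κ‖ * P.h₁) := by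
  have hρ := P.ρ₁_pos
  have hh := P.h₁_pos
  rcases eq_or_ne κ 0 with rfl | hκ
  · simp [sourceKernel]
  · have hκ' : 0 < ‖κ‖ := norm_pos_iff.2 hκ
    have hs : 0 < Real.sinh (2 * Real.pi * ‖κ‖ * P.h₁) := Real.sinh_pos_iff.2 (by positivity)
    have hc := Real.cosh_pos (2 * Real.pi * ‖κ‖ * P.h₁)
    have h1 : P.ρ₁ * Real.cosh (2 * Real.pi * ‖κ‖ * P.h₁) ≤
        Real.sinh (2 * Real.pi * ‖κ‖ * P.h₁) * (T₁ P κ + T₂ P κ) := by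
      have : Real.sinh (2 * Real.pi * ‖κ‖ * P.h₁) * T₁ P κ =
          P.ρ₁ * Real.cosh (2 * Real.pi * ‖κ‖ * P.h₁) := by
        unfold T₁ coth; field_simp
      rw [mul_add, this]
      nlinarith [mul_nonneg hs.le (T₂_nonneg P κ)]
    calc sourceKernel P κ
        ≤ 2 * Real.pi * P.ρ₁ * ‖κ‖ / (P.ρ₁ * Real.cosh (2 * Real.pi * ‖κ‖ * P.h₁)) := by
          unfold sourceKernel; gcongr
      _ = _ := by field_simp

/-- From $2\cosh x\ge e^x\ge1+x+x^2/2$. It controls both $|\kappa|/\cosh$ and $|\kappa|^2/\cosh$. -/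
theorem add_sq_le_cosh {x : ℝ} (hx : 0 ≤ x) : x + x ^ 2 ≤ 4 * Real.cosh x := by
  have h1 := Real.quadratic_le_exp_of_nonneg hx
  have h2 := Real.cosh_eq x
  have h3 := Real.exp_pos (-x)
  nlinarith

/-- The source multiplier gains a power of the weight. -/
theorem exists_weight_mul_sourceKernel_le (P : Fluid) (ε : ℝ) :
    ∃ C, ∀ κ : Space d, weight P ε κ * sourceKernel P κ ≤ C := by
  have hρ := P.ρ₁_pos
  have hg := P.grav_pos
  have hd : 0 < P.ρ₂ - P.ρ₁ := sub_pos.2 P.ρ₁_lt_ρ₂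
  have hh := P.h₁_pos
  set c := 2 * Real.pi * (P.ρ₂ - P.ρ₁) * P.grav / P.ρ₁
  have hc : 0 ≤ c := by positivity
  set a := 2 * Real.pi * P.h₁ with ha
  have ha0 : 0 < a := by positivity
  refine ⟨2 * Real.pi * ((1 + ε ^ 2) * (4 / a) + c * (4 / a ^ 2)), fun κ => ?_⟩
  have hcosh := Real.cosh_pos (2 * Real.pi * ‖κ‖ * P.h₁)
  have hx : 2 * Real.pi * ‖κ‖ * P.h₁ = a * ‖κ‖ := by rw [ha]; ring
  have hq : a * ‖κ‖ + (a * ‖κ‖) ^ 2 ≤ 4 * Real.cosh (2 * Real.pi * ‖κ‖ * P.h₁) := by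
    rw [hx]; exact add_sq_le_cosh (by positivity)
  have h1 : ‖κ‖ ≤ 4 / a * Real.cosh (2 * Real.pi * ‖κ‖ * P.h₁) := by
    rw [div_mul_eq_mul_div, le_div_iff₀ ha0]; nlinarith [sq_nonneg (a * ‖κ‖)]
  have h2 : ‖κ‖ ^ 2 ≤ 4 / a ^ 2 * Real.cosh (2 * Real.pi * ‖κ‖ * P.h₁) := by
    rw [div_mul_eq_mul_div, le_div_iff₀ (by positivity)]
    nlinarith [mul_nonneg ha0.le (norm_nonneg κ)]
  -- As the weight is at least one, it is at most its square, which grows linearly; this crude bound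
  -- is enough against `cosh`.
  have hw : weight P ε κ ≤ 1 + ε ^ 2 + c * ‖κ‖ := by
    have := one_le_weight P ε κ
    have := weight_sq P ε κ
    have := omega_sq_le P κ
    nlinarith
  calc weight P ε κ * sourceKernel P κ
      ≤ (1 + ε ^ 2 + c * ‖κ‖) *
          (2 * Real.pi * ‖κ‖ / Real.cosh (2 * Real.pi * ‖κ‖ * P.h₁)) := by
        gcongr
        · exact sourceKernel_nonneg P κ
        · exact sourceKernel_le P κ
    _ = 2 * Real.pi * ((1 + ε ^ 2) * ‖κ‖ + c * ‖κ‖ ^ 2) /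
          Real.cosh (2 * Real.pi * ‖κ‖ * P.h₁) := by ring
    _ ≤ _ := by
        rw [div_le_iff₀ hcosh]
        calc _ ≤ 2 * Real.pi * ((1 + ε ^ 2) * (4 / a * Real.cosh (2 * Real.pi * ‖κ‖ * P.h₁)) +
              c * (4 / a ^ 2 * Real.cosh (2 * Real.pi * ‖κ‖ * P.h₁))) := by gcongr
          _ = _ := by ring

theorem memLp_of_weight_mul {P : Fluid} {ε : ℝ} {m : Space d → ℂ} {β : Space d → ℝ}
    (hβ : MemLp (fun κ => weight P ε κ * β κ) 2 volume) (hm : AEStronglyMeasurable m volume)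
    (hle : ∀ κ, ‖m κ‖ ≤ weight P ε κ * β κ) : MemLp m 2 volume :=
  hβ.of_le hm (ae_of_all _ fun κ => (hle κ).trans (le_abs_self _))

/-- Dominating function for the source term of a ship of unit velocity. -/
def sourceBound (P : Fluid) (f : L2 d) (κ : Space d) : ℝ := sourceKernel P κ * ‖(𝓕 f : L2 d) κ‖

theorem sourceBound_nonneg (P : Fluid) (f : L2 d) (κ : Space d) : 0 ≤ sourceBound P f κ :=
  mul_nonneg (sourceKernel_nonneg P κ) (norm_nonneg _)

theorem memLp_weight_mul_sourceBound (P : Fluid) (ε : ℝ) (f : L2 d) :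
    MemLp (fun κ => weight P ε κ * sourceBound P f κ) 2 volume := by
  obtain ⟨C, hC⟩ := exists_weight_mul_sourceKernel_le (d := d) P ε
  refine (Lp.memLp (𝓕 f : L2 d)).of_le_mul (c := C) ?_ (ae_of_all _ fun κ => ?_)
  · exact (measurable_weight P ε).aestronglyMeasurable.mul
      ((measurable_sourceKernel P).aestronglyMeasurable.mul (Lp.aestronglyMeasurable _).norm)
  · rw [Real.norm_of_nonneg (mul_nonneg (weight_nonneg P ε κ) (sourceBound_nonneg P f κ)),
      sourceBound, ← mul_assoc]
    exact mul_le_mul_of_nonneg_right (hC κ) (norm_nonneg _)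

/-- The phase has modulus one, so the position drops out; Cauchy–Schwarz bounds the factor `inner ℝ
κ u`. -/
theorem norm_sourceAt_le (P : Fluid) (f : L2 d) (u x κ : Space d) :
    ‖sourceAt P f u x κ‖ ≤ ‖u‖ * sourceBound P f κ := by
  have hρ := P.ρ₁_pos
  have hh := P.h₁_pos
  have hT := add_nonneg (T₁_nonneg P κ) (T₂_nonneg P κ)
  have hs : 0 ≤ Real.sinh (2 * Real.pi * ‖κ‖ * P.h₁) := Real.sinh_nonneg_iff.2 (by positivity)
  have he : ‖Complex.exp (-2 * (Real.pi : ℂ) * Complex.I * ((inner ℝ κ x : ℝ) : ℂ))‖ = 1 := by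
    rw [Complex.norm_exp]; simp
  have hi : |inner ℝ κ u| ≤ ‖κ‖ * ‖u‖ := abs_real_inner_le_norm κ u
  rw [sourceAt, norm_div, norm_mul, norm_mul, he, Complex.norm_real,
    Real.norm_of_nonneg (mul_nonneg hs hT)]
  simp only [norm_mul, Complex.norm_real, Complex.norm_I, Real.norm_eq_abs, mul_one,
    abs_of_pos hρ, abs_of_pos Real.pi_pos, Complex.norm_ofNat]
  calc 2 * Real.pi * P.ρ₁ * |inner ℝ κ u| * ‖(𝓕 f : L2 d) κ‖ /
        (Real.sinh (2 * Real.pi * ‖κ‖ * P.h₁) * (T₁ P κ + T₂ P κ))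
      ≤ 2 * Real.pi * P.ρ₁ * (‖κ‖ * ‖u‖) * ‖(𝓕 f : L2 d) κ‖ /
        (Real.sinh (2 * Real.pi * ‖κ‖ * P.h₁) * (T₁ P κ + T₂ P κ)) := by gcongr
    _ = _ := by unfold sourceBound sourceKernel; ring

theorem continuous_sourceAt (P : Fluid) (f : L2 d) (κ : Space d) :
    Continuous fun q : Space d × Space d => sourceAt P f q.1 q.2 κ := by
  unfold sourceAt; fun_prop

/-- The Fourier transform of `f` is known only almost everywhere, so composing it with `k` requires
`k` to be quasi-measure-preserving. The generality covers functions of `κ`, of `(t, κ)` and of `((t,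
κ), τ)`. -/
theorem aestronglyMeasurable_sourceAt_comp (P : Fluid) (f : L2 d) {α : Type*} [MeasurableSpace α]
    {m : Measure α} {u x k : α → Space d} (hu : AEStronglyMeasurable u m)
    (hx : AEStronglyMeasurable x m) (hk : Measure.QuasiMeasurePreserving k m volume) :
    AEStronglyMeasurable (fun q => sourceAt P f (u q) (x q) (k q)) m := by
  have h1 := measurable_sinh_mul (d := d) P
  have h2 : AEStronglyMeasurable (fun q => (𝓕 f : L2 d) (k q)) m :=
    (Lp.aestronglyMeasurable (𝓕 f : L2 d)).comp_quasiMeasurePreserving hk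
  have h3 : AEStronglyMeasurable (fun κ : Space d =>
    (((Real.sinh (2 * Real.pi * ‖κ‖ * P.h₁) * (T₁ P κ + T₂ P κ) : ℝ) : ℂ))⁻¹) volume :=
    (Measurable.inv (by fun_prop)).aestronglyMeasurable
  have hk' : AEStronglyMeasurable k m := hk.measurable.aestronglyMeasurable
  unfold sourceAt
  simp only [div_eq_mul_inv]
  refine AEStronglyMeasurable.mul (AEStronglyMeasurable.mul (AEStronglyMeasurable.mul ?_ ?_) h2)
    (h3.comp_quasiMeasurePreserving hk)
  · exact aestronglyMeasurable_const.mul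
      (Complex.continuous_ofReal.comp_aestronglyMeasurable (hk'.inner hu))
  · exact Complex.continuous_exp.comp_aestronglyMeasurable
      (aestronglyMeasurable_const.mul
        (Complex.continuous_ofReal.comp_aestronglyMeasurable (hk'.inner hx)))

theorem aestronglyMeasurable_sourceAt (P : Fluid) (f : L2 d) (u x : Space d) :
    AEStronglyMeasurable (sourceAt P f u x) volume :=
  aestronglyMeasurable_sourceAt_comp P f aestronglyMeasurable_const aestronglyMeasurable_const
    (Measure.QuasiMeasurePreserving.id _)

/-- Joint measurability of the source term in time and frequency. -/
theorem aestronglyMeasurable_source (P : Fluid) (f : L2 d) {U : ℝ → Space d} {ρ : Measure ℝ}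
    [SFinite ρ] (hU : AEStronglyMeasurable U ρ) (hX : AEStronglyMeasurable (position U) ρ) :
    AEStronglyMeasurable (fun q : ℝ × Space d => source P f U q.1 q.2) (ρ.prod volume) :=
  aestronglyMeasurable_sourceAt_comp P f hU.comp_fst hX.comp_fst
    Measure.quasiMeasurePreserving_snd

theorem memLp_sourceBound (P : Fluid) (f : L2 d) : MemLp (sourceBound P f) 2 volume := by
  refine (memLp_weight_mul_sourceBound P 0 f).of_le ?_ (ae_of_all _ fun κ => ?_)
  · exact (measurable_sourceKernel P).aestronglyMeasurable.mul (Lp.aestronglyMeasurable _).norm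
  · have h0 := sourceBound_nonneg P f κ
    rw [Real.norm_of_nonneg h0, Real.norm_of_nonneg (mul_nonneg (weight_nonneg P 0 κ) h0)]
    exact le_mul_of_one_le_left h0 (one_le_weight P 0 κ)

theorem memLp_sourceAt (P : Fluid) (f : L2 d) (u x : Space d) :
    MemLp (sourceAt P f u x) 2 volume :=
  (memLp_sourceBound P f).of_le_mul (aestronglyMeasurable_sourceAt P f u x)
    (ae_of_all _ fun κ => (norm_sourceAt_le P f u x κ).trans
      (mul_le_mul_of_nonneg_left (le_abs_self _) (norm_nonneg u)))

/-- The source term depends continuously in `L²` on the velocity and position of the ship. -/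
theorem continuous_toL2_sourceAt (P : Fluid) (f : L2 d) :
    Continuous fun q : Space d × Space d => toL2 (sourceAt P f q.1 q.2) := by
  rw [continuous_iff_continuousAt]
  intro q₀
  have hev : ∀ᶠ q : Space d × Space d in 𝓝 q₀, ‖q.1‖ < ‖q₀.1‖ + 1 :=
    (continuous_fst.norm.tendsto q₀).eventually_lt_const (by simp)
  refine tendsto_toL2 (β := fun κ => (‖q₀.1‖ + 1) * sourceBound P f κ)
    ((memLp_sourceBound P f).const_mul _)
    (Eventually.of_forall fun q => aestronglyMeasurable_sourceAt P f _ _)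
    (aestronglyMeasurable_sourceAt P f _ _) ?_ (fun κ => ?_)
    (fun κ => (continuous_sourceAt P f κ).tendsto q₀)
  · filter_upwards [hev] with q hq κ
    exact (norm_sourceAt_le P f _ _ κ).trans
      (mul_le_mul_of_nonneg_right hq.le (sourceBound_nonneg P f κ))
  · exact (norm_sourceAt_le P f _ _ κ).trans
      (mul_le_mul_of_nonneg_right (by linarith) (sourceBound_nonneg P f κ))

end Multipliers

/-! ### The Duhamel formula frequency by frequency -/

section DuhamelFormula

variable {d : ℕ}

theorem memLp_weight_mul_norm {P : Fluid} {ε : ℝ} {b : L2 d} (hb : b ∈ domain P ε) :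
    MemLp (fun κ => weight P ε κ * ‖b κ‖) 2 volume := by
  have hs : MemLp (fun κ => symbol P ε κ * b κ) 2 volume := hb
  refine ((Lp.memLp b).norm.add hs.norm).of_le
    ((measurable_weight P ε).aestronglyMeasurable.mul (Lp.aestronglyMeasurable b).norm)
    (ae_of_all _ fun κ => ?_)
  rw [Real.norm_of_nonneg (mul_nonneg (weight_nonneg P ε κ) (norm_nonneg _)), Pi.add_apply,
    Real.norm_of_nonneg (by positivity), norm_mul]
  nlinarith [mul_le_mul_of_nonneg_right (weight_le_add P ε κ) (norm_nonneg (b κ))]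

theorem domainNorm_eq (P : Fluid) (ε : ℝ) (b : L2 d) :
    domainNorm P ε b = Real.sqrt (∫ κ, weight P ε κ ^ 2 * ‖b κ‖ ^ 2) := by
  simp only [domainNorm, weight_sq]

theorem sub_mem_domain {P : Fluid} {ε : ℝ} {b c : L2 d} (hb : b ∈ domain P ε)
    (hc : c ∈ domain P ε) : b - c ∈ domain P ε := by
  have hb' : MemLp (fun κ => symbol P ε κ * b κ) 2 volume := hb
  have hc' : MemLp (fun κ => symbol P ε κ * c κ) 2 volume := hc
  refine (memLp_congr_ae ?_).1 (hb'.sub hc')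
  filter_upwards [Lp.coeFn_sub b c] with κ h
  rw [h, Pi.sub_apply, Pi.sub_apply, ← mul_sub]; rfl

/-- The weight is at least one. Membership in the domain makes the weighted integral finite; a
divergent one would take the default value `0`. -/
theorem norm_le_domainNorm {P : Fluid} {ε : ℝ} {b : L2 d} (hb : b ∈ domain P ε) :
    ‖b‖ ≤ domainNorm P ε b := by
  rw [domainNorm_eq]
  refine Real.le_sqrt_of_sq_le ?_
  rw [L2_norm_sq]
  have h := (memLp_weight_mul_norm hb).integrable_sq
  simp only [mul_pow] at h
  refine integral_mono (Lp.memLp b).norm.integrable_sq h fun κ => ?_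
  exact le_mul_of_one_le_left (sq_nonneg _) (one_le_pow₀ (one_le_weight P ε κ))

theorem continuousOn_of_continuousInDomain {P : Fluid} {ε T : ℝ} {μ : ℝ → L2 d}
    (h : ContinuousInDomain P ε T μ) : ContinuousOn μ (Icc 0 T) := by
  intro t₀ ht₀
  rw [ContinuousWithinAt, tendsto_iff_norm_sub_tendsto_zero]
  refine tendsto_of_tendsto_of_tendsto_of_le_of_le' tendsto_const_nhds (h.2 t₀ ht₀)
    (Eventually.of_forall fun t => norm_nonneg _) ?_
  filter_upwards [self_mem_nhdsWithin] with t ht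
  exact norm_le_domainNorm (sub_mem_domain (h.1 t ht) (h.1 t₀ ht₀))

theorem continuousOn_position {U : ℝ → Space d} {T : ℝ} (hT : 0 ≤ T)
    (hU : IntegrableOn U (Ioo 0 T)) : ContinuousOn (position U) (Icc 0 T) := by
  have := intervalIntegral.continuousOn_primitive_interval (a := (0 : ℝ)) (b := T) (f := U)
    (μ := volume) (by rwa [uIcc_of_le hT, integrableOn_Icc_iff_integrableOn_Ioo])
  rwa [uIcc_of_le hT] at this

theorem aestronglyMeasurable_position {U : ℝ → Space d} {T : ℝ} (hT : 0 ≤ T)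
    (hU : IntegrableOn U (Ioo 0 T)) :
    AEStronglyMeasurable (position U) (volume.restrict (Ioo 0 T)) :=
  ((continuousOn_position hT hU).mono Ioo_subset_Icc_self).aestronglyMeasurable measurableSet_Ioo

/-- The source term transported back to time `0` by the group generated by `A_ε`. -/
def pulledSource (P : Fluid) (ε : ℝ) (f : L2 d) (U : ℝ → Space d) (τ : ℝ) (κ : Space d) : ℂ :=
  Complex.exp (symbol P ε κ * ((-τ : ℝ) : ℂ)) * source P f U τ κ

/-- Duhamel's formula, up to the factor `e^{iω_{κ,ε}t}`. -/
def duhamelAmplitude (P : Fluid) (ε : ℝ) (f : L2 d) (U : ℝ → Space d) (μ₀ : L2 d) (t : ℝ)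
    (κ : Space d) : ℂ :=
  μ₀ κ - ∫ τ in (0 : ℝ)..t, pulledSource P ε f U τ κ

/-- The right-hand side of Duhamel's formula. -/
def duhamelSol (P : Fluid) (ε : ℝ) (f : L2 d) (U : ℝ → Space d) (μ₀ : L2 d) (t : ℝ)
    (κ : Space d) : ℂ :=
  Complex.exp (symbol P ε κ * (t : ℂ)) * duhamelAmplitude P ε f U μ₀ t κ

/-- A dominating function for Duhamel's formula on `[0,T]`. -/
def duhamelBound (P : Fluid) (ε T : ℝ) (f : L2 d) (U : ℝ → Space d) (μ₀ : L2 d)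
    (κ : Space d) : ℝ :=
  ‖μ₀ κ‖ + (Real.exp (ε * T) * ∫ τ in Ioo 0 T, ‖U τ‖) * sourceBound P f κ

variable {P : Fluid} {ε T : ℝ} {f : L2 d} {U : ℝ → Space d} {μ₀ : L2 d}

/-- Pulling back to time `0` undoes the damping and amplifies by $e^{\varepsilon\tau}\le
e^{\varepsilon T}$. -/
theorem norm_pulledSource_le (hε : 0 ≤ ε) {τ : ℝ} (hτ : τ ≤ T) (κ : Space d) :
    ‖pulledSource P ε f U τ κ‖ ≤ ‖U τ‖ * (Real.exp (ε * T) * sourceBound P f κ) := by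
  rw [pulledSource, norm_mul, norm_exp_symbol]
  calc Real.exp (-ε * -τ) * ‖source P f U τ κ‖
      ≤ Real.exp (ε * T) * (‖U τ‖ * sourceBound P f κ) := by
        refine mul_le_mul (Real.exp_le_exp.2 (by nlinarith)) (norm_sourceAt_le P f _ _ κ)
          (norm_nonneg _) (Real.exp_pos _).le
    _ = _ := by ring

theorem aestronglyMeasurable_source_time (hT : 0 ≤ T) (hU : IntegrableOn U (Ioo 0 T))
    (κ : Space d) :
    AEStronglyMeasurable (fun τ => source P f U τ κ) (volume.restrict (Ioo 0 T)) := by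
  have h : AEStronglyMeasurable (fun τ => (U τ, position U τ)) (volume.restrict (Ioo 0 T)) :=
    hU.aestronglyMeasurable.prodMk (aestronglyMeasurable_position hT hU)
  have h' := (continuous_sourceAt P f κ).comp_aestronglyMeasurable h
  simp only [source_eq_sourceAt]
  exact h'

theorem integrableOn_pulledSource (hε : 0 ≤ ε) (hT : 0 ≤ T) (hU : IntegrableOn U (Ioo 0 T))
    (κ : Space d) : IntegrableOn (fun τ => pulledSource P ε f U τ κ) (Ioo 0 T) := by
  refine (hU.norm.mul_const (Real.exp (ε * T) * sourceBound P f κ)).mono' ?_ ?_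
  · refine AEStronglyMeasurable.mul ?_ (aestronglyMeasurable_source_time hT hU κ)
    exact Continuous.aestronglyMeasurable (by fun_prop)
  · filter_upwards [ae_restrict_mem measurableSet_Ioo] with τ hτ
    exact norm_pulledSource_le hε hτ.2.le κ

theorem sourceBound_coeff_nonneg (ε T : ℝ) (U : ℝ → Space d) :
    0 ≤ Real.exp (ε * T) * ∫ τ in Ioo 0 T, ‖U τ‖ :=
  mul_nonneg (Real.exp_pos _).le (integral_nonneg fun _ => norm_nonneg _)

theorem duhamelBound_nonneg (κ : Space d) : 0 ≤ duhamelBound P ε T f U μ₀ κ :=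
  add_nonneg (norm_nonneg _) (mul_nonneg (sourceBound_coeff_nonneg ε T U)
    (sourceBound_nonneg P f κ))

theorem norm_duhamelAmplitude_le (hε : 0 ≤ ε) (hU : IntegrableOn U (Ioo 0 T))
    {t : ℝ} (ht : t ∈ Icc 0 T) (κ : Space d) :
    ‖duhamelAmplitude P ε f U μ₀ t κ‖ ≤ duhamelBound P ε T f U μ₀ κ := by
  refine (norm_sub_le _ _).trans (add_le_add_right ?_ _)
  have hsub : Ioo 0 t ⊆ Ioo 0 T := Ioo_subset_Ioo_right ht.2
  rw [intervalIntegral.integral_of_le ht.1, integral_Ioc_eq_integral_Ioo]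
  calc ‖∫ τ in Ioo 0 t, pulledSource P ε f U τ κ‖
      ≤ ∫ τ in Ioo 0 t, ‖U τ‖ * (Real.exp (ε * T) * sourceBound P f κ) := by
        refine norm_integral_le_of_norm_le ((hU.mono_set hsub).norm.mul_const _) ?_
        filter_upwards [ae_restrict_mem measurableSet_Ioo] with τ hτ
        exact norm_pulledSource_le hε (hsub hτ).2.le κ
    _ = (∫ τ in Ioo 0 t, ‖U τ‖) * (Real.exp (ε * T) * sourceBound P f κ) :=
        integral_mul_const _ _
    _ ≤ (∫ τ in Ioo 0 T, ‖U τ‖) * (Real.exp (ε * T) * sourceBound P f κ) := by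
        refine mul_le_mul_of_nonneg_right
          (setIntegral_mono_set hU.norm (ae_of_all _ fun _ => norm_nonneg _)
            hsub.eventuallyLE)
          (mul_nonneg (Real.exp_pos _).le (sourceBound_nonneg P f κ))
    _ = _ := by ring

theorem norm_duhamelSol_le (hε : 0 ≤ ε) (hU : IntegrableOn U (Ioo 0 T))
    {t : ℝ} (ht : t ∈ Icc 0 T) (κ : Space d) :
    ‖duhamelSol P ε f U μ₀ t κ‖ ≤ duhamelBound P ε T f U μ₀ κ := by
  rw [duhamelSol, norm_mul, norm_exp_symbol]
  refine (mul_le_of_le_one_left (norm_nonneg _) ?_).trans (norm_duhamelAmplitude_le hε hU ht κ)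
  exact Real.exp_le_one_iff.2 (by nlinarith [ht.1])

theorem continuousOn_duhamelSol (hε : 0 ≤ ε) (hT : 0 ≤ T) (hU : IntegrableOn U (Ioo 0 T))
    (κ : Space d) : ContinuousOn (fun t => duhamelSol P ε f U μ₀ t κ) (Icc 0 T) := by
  have h := intervalIntegral.continuousOn_primitive_interval (a := (0 : ℝ)) (b := T)
    (f := fun τ => pulledSource P ε f U τ κ) (μ := volume)
    (by rw [uIcc_of_le hT, integrableOn_Icc_iff_integrableOn_Ioo]
        exact integrableOn_pulledSource hε hT hU κ)
  rw [uIcc_of_le hT] at h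
  exact Continuous.continuousOn (by fun_prop) |>.mul (continuousOn_const.sub h)

theorem aestronglyMeasurable_duhamelSol (hT : 0 ≤ T) (hU : IntegrableOn U (Ioo 0 T))
    {t : ℝ} (ht : t ∈ Icc 0 T) : AEStronglyMeasurable (duhamelSol P ε f U μ₀ t) volume := by
  have hsub : Ioo 0 t ⊆ Ioo 0 T := Ioo_subset_Ioo_right ht.2
  have hsy := measurable_symbol (d := d) P ε
  have h1 : AEStronglyMeasurable (fun q : Space d × ℝ => pulledSource P ε f U q.2 q.1)
      (volume.prod (volume.restrict (Ioo 0 t))) := by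
    refine AEStronglyMeasurable.mul (Measurable.aestronglyMeasurable (by fun_prop)) ?_
    exact (aestronglyMeasurable_source P f (hU.mono_set hsub).aestronglyMeasurable
      ((aestronglyMeasurable_position hT hU).mono_set hsub)).prod_swap
  unfold duhamelSol duhamelAmplitude
  refine AEStronglyMeasurable.mul (Measurable.aestronglyMeasurable (by fun_prop))
    ((Lp.aestronglyMeasurable μ₀).sub ?_)
  simp only [intervalIntegral.integral_of_le ht.1, integral_Ioc_eq_integral_Ioo]
  exact h1.integral_prod_right'

theorem aestronglyMeasurable_uncurry_duhamelSol (hT : 0 ≤ T) (hU : IntegrableOn U (Ioo 0 T)) :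
    AEStronglyMeasurable (Function.uncurry (duhamelSol P ε f U μ₀))
      ((volume.restrict (Ioo 0 T)).prod volume) := by
  set ρ : Measure ℝ := volume.restrict (Ioo 0 T)
  have hsy := measurable_symbol (d := d) P ε
  have hX := aestronglyMeasurable_position hT hU
  -- The indicator of `τ ≤ t` replaces the moving endpoint by a fixed domain of integration, so
  -- measurability of parameter integrals applies jointly in `(t, κ)`.
  have h1 : AEStronglyMeasurable
      (indicator {q : (ℝ × Space d) × ℝ | q.2 ≤ q.1.1}
        fun q => pulledSource P ε f U q.2 q.1.2) ((ρ.prod volume).prod ρ) := by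
    refine AEStronglyMeasurable.indicator (AEStronglyMeasurable.mul
      (Measurable.aestronglyMeasurable (by fun_prop)) ?_)
      (measurableSet_le measurable_snd (by fun_prop))
    exact aestronglyMeasurable_sourceAt_comp P f hU.aestronglyMeasurable.comp_snd hX.comp_snd
      (Measure.quasiMeasurePreserving_snd.comp Measure.quasiMeasurePreserving_fst)
  have h2 : AEStronglyMeasurable (fun q : ℝ × Space d => Complex.exp (symbol P ε q.2 * (q.1 : ℂ)) *
      (μ₀ q.2 - ∫ τ, indicator {q : (ℝ × Space d) × ℝ | q.2 ≤ q.1.1}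
        (fun q => pulledSource P ε f U q.2 q.1.2) (q, τ) ∂ρ)) (ρ.prod volume) :=
    AEStronglyMeasurable.mul (Measurable.aestronglyMeasurable (by fun_prop))
      ((Lp.aestronglyMeasurable μ₀).comp_snd.sub h1.integral_prod_right')
  refine h2.congr ?_
  have hmem : ∀ᵐ q : ℝ × Space d ∂ρ.prod volume, q.1 ∈ Ioo 0 T :=
    Measure.quasiMeasurePreserving_fst.ae (ae_restrict_mem measurableSet_Ioo)
  filter_upwards [hmem] with q hq
  have : (fun τ => indicator {q : (ℝ × Space d) × ℝ | q.2 ≤ q.1.1}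
      (fun q => pulledSource P ε f U q.2 q.1.2) (q, τ)) =
      indicator (Iic q.1) fun τ => pulledSource P ε f U τ q.2 := by
    ext τ; simp [indicator]
  rw [Function.uncurry, duhamelSol, duhamelAmplitude, this, integral_indicator measurableSet_Iic,
    Measure.restrict_restrict measurableSet_Iic, intervalIntegral.integral_of_le hq.1.le]
  congr 4
  ext τ; simp only [mem_Ioc, mem_inter_iff, mem_Iic, mem_Ioo]
  exact ⟨fun h => ⟨h.2.1, h.1⟩, fun h => ⟨h.2, h.1, h.2.trans_lt hq.2⟩⟩

theorem memLp_weight_mul_duhamelBound (hμ₀ : μ₀ ∈ domain P ε) :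
    MemLp (fun κ => weight P ε κ * duhamelBound P ε T f U μ₀ κ) 2 volume := by
  refine ((memLp_weight_mul_norm hμ₀).add ((memLp_weight_mul_sourceBound P ε f).const_mul
    (Real.exp (ε * T) * ∫ τ in Ioo 0 T, ‖U τ‖))).ae_eq (ae_of_all _ fun κ => ?_)
  simp only [Pi.add_apply, duhamelBound]; ring

theorem duhamelBound_le_weight_mul (κ : Space d) :
    duhamelBound P ε T f U μ₀ κ ≤ weight P ε κ * duhamelBound P ε T f U μ₀ κ :=
  le_mul_of_one_le_left (duhamelBound_nonneg κ) (one_le_weight P ε κ)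

/-- Duhamel's formula satisfies the equation in the sense of distributions, for every frequency. -/
theorem integral_deriv_mul_duhamelSol (hε : 0 ≤ ε) (hT : 0 ≤ T) (hU : IntegrableOn U (Ioo 0 T))
    {φ : ℝ → ℝ} (hφ : ContDiff ℝ (⊤ : ℕ∞) φ) (hs : tsupport φ ⊆ Ioo 0 T) (κ : Space d) :
    ∫ t in Ioo 0 T, (((deriv φ t : ℝ) : ℂ) * duhamelSol P ε f U μ₀ t κ +
      (φ t : ℂ) * (symbol P ε κ * duhamelSol P ε f U μ₀ t κ - source P f U t κ)) = 0 := by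
  set l := symbol P ε κ
  have hd : Continuous (deriv φ) := hφ.continuous_deriv (by simp)
  have hφc := hφ.continuous
  have hφ0 : φ 0 = 0 := image_eq_zero_of_notMem_tsupport fun h' => lt_irrefl _ (hs h').1
  have hφT : φ T = 0 := image_eq_zero_of_notMem_tsupport fun h' => lt_irrefl _ (hs h').2
  set y : ℝ → ℂ := fun τ => pulledSource P ε f U τ κ
  have hy : IntegrableOn y (Ioc 0 T) := by
    rw [integrableOn_Ioc_iff_integrableOn_Ioo]; exact integrableOn_pulledSource hε hT hU κ
  -- With the exponential absorbed into the test function, `φ' μ + φ l μ` becomes `Φ'` times the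
  -- amplitude: a constant minus the primitive of `y`.
  set Φ : ℝ → ℂ := fun t => (φ t : ℂ) * Complex.exp (l * (t : ℂ))
  set Φ' : ℝ → ℂ := fun t => (((deriv φ t : ℝ) : ℂ) + (φ t : ℂ) * l) * Complex.exp (l * (t : ℂ))
  have hΦ : ∀ t, HasDerivAt Φ (Φ' t) t := by
    intro t
    have h1 : HasDerivAt (fun t : ℝ => (φ t : ℂ)) ((deriv φ t : ℝ) : ℂ) t :=
      ((hφ.differentiable (by simp) t).hasDerivAt).ofReal_comp
    have h2 : HasDerivAt (fun t : ℝ => Complex.exp (l * (t : ℂ)))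
        (Complex.exp (l * (t : ℂ)) * (l * 1)) t :=
      ((Complex.ofRealCLM.hasDerivAt (x := t)).const_mul l).cexp
    exact (h1.mul h2).congr_deriv (by simp only [Φ']; ring)
  have hΦ' : Continuous Φ' := by fun_prop
  have hΦc : Continuous Φ := by fun_prop
  have hparts := integral_deriv_smul_primitive (𝕜 := ℂ) (E := ℂ) hΦ hΦ' hy
  -- This removes the initial datum; the other two terms cancel through `hparts`, as `Φ T = 0`.
  have hftc : ∫ t in Ioc 0 T, Φ' t = 0 := by
    rw [← intervalIntegral.integral_of_le hT,
      intervalIntegral.integral_eq_sub_of_hasDerivAt (fun t _ => hΦ t)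
        (hΦ'.intervalIntegrable _ _)]
    simp [Φ, hφ0, hφT]
  have hprim : ContinuousOn (fun t => ∫ s in (0 : ℝ)..t, y s) (Icc 0 T) := by
    have := intervalIntegral.continuousOn_primitive_interval (a := (0 : ℝ)) (b := T) (f := y)
      (μ := volume) (by rwa [uIcc_of_le hT, integrableOn_Icc_iff_integrableOn_Ioc])
    rwa [uIcc_of_le hT] at this
  have hi1 : IntegrableOn (fun t => Φ' t * μ₀ κ) (Ioc 0 T) :=
    ((by fun_prop : Continuous fun t => Φ' t * μ₀ κ).integrableOn_Icc).mono_set Ioc_subset_Icc_self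
  have hi2 : IntegrableOn (fun t => Φ' t • ∫ s in (0 : ℝ)..t, y s) (Ioc 0 T) :=
    ((hΦ'.continuousOn.smul hprim).integrableOn_Icc).mono_set Ioc_subset_Icc_self
  have hi3 : IntegrableOn (fun t => Φ t * y t) (Ioc 0 T) := by
    have : IntegrableOn y (Icc 0 T) := by rwa [integrableOn_Icc_iff_integrableOn_Ioc]
    exact (this.continuousOn_mul hΦc.continuousOn isCompact_Icc).mono_set Ioc_subset_Icc_self
  have hexp : ∀ t : ℝ, Complex.exp (l * (t : ℂ)) * Complex.exp (l * ((-t : ℝ) : ℂ)) = 1 := by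
    intro t
    rw [← Complex.exp_add]; simp
  have heq : ∀ t, ((deriv φ t : ℝ) : ℂ) * duhamelSol P ε f U μ₀ t κ +
      (φ t : ℂ) * (l * duhamelSol P ε f U μ₀ t κ - source P f U t κ) =
      Φ' t * μ₀ κ - Φ' t • (∫ s in (0 : ℝ)..t, y s) - Φ t * y t := by
    intro t
    have : Φ t * y t = φ t * source P f U t κ := by
      simp only [Φ, y, pulledSource]
      calc _ = φ t * (Complex.exp (l * (t : ℂ)) * Complex.exp (l * ((-t : ℝ) : ℂ))) *
            source P f U t κ := by ring
        _ = _ := by rw [hexp, mul_one]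
    rw [this, duhamelSol, duhamelAmplitude, smul_eq_mul]
    simp only [Φ', y]; ring
  simp only [heq]
  rw [← integral_Ioc_eq_integral_Ioo]
  have hi12 : IntegrableOn (fun t => Φ' t * μ₀ κ - Φ' t • (∫ s in (0 : ℝ)..t, y s)) (Ioc 0 T) :=
    hi1.sub hi2
  rw [integral_sub hi12 hi3, integral_sub hi1 hi2, hparts, integral_mul_const, hftc]
  simp [Φ, hφT, integral_neg]

end DuhamelFormula

/-! ### Uniqueness by frequency cutoff -/

section Uniqueness

variable {d : ℕ} {P : Fluid} {ε T : ℝ} {p : ENNReal} {f : L2 d} {U : ℝ → Space d} {μ₀ : L2 d}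

/-- A continuous primitive of a bounded linear operator applied to itself vanishes. -/
theorem eqOn_zero_of_eq_integral {E : Type*} [NormedAddCommGroup E] [NormedSpace ℝ E]
    [CompleteSpace E] (hT : 0 ≤ T) (Λ : E →L[ℝ] E) {g : ℝ → E} (hg : ContinuousOn g (Icc 0 T))
    (h : ∀ t ∈ Icc 0 T, g t = ∫ s in (0 : ℝ)..t, Λ (g s)) : EqOn g (fun _ => 0) (Icc 0 T) := by
  -- Freezing `g` outside `[0, T]` makes the integrand continuous on the whole line, so its
  -- primitive is differentiable everywhere and `g` solves a Lipschitz ODE.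
  set G : ℝ → E := fun s => Λ (g (projIcc 0 T hT s))
  have hG : Continuous G :=
    Λ.continuous.comp ((continuousOn_iff_continuous_domRestrict.1 hg).comp continuous_projIcc)
  have hgG : ∀ t ∈ Icc 0 T, g t = ∫ s in (0 : ℝ)..t, G s := by
    intro t ht
    rw [h t ht]
    refine intervalIntegral.integral_congr fun s hs => ?_
    rw [uIcc_of_le ht.1] at hs
    simp only [G, projIcc_of_mem hT ⟨hs.1, hs.2.trans ht.2⟩]
  refine ODE_solution_unique (v := fun _ x => Λ x) (K := ‖Λ‖₊) (fun _ => Λ.lipschitz) hg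
    (fun t ht => ?_) continuousOn_const
    (fun t _ => by simpa using hasDerivWithinAt_const t (Ici t) (0 : E)) ?_
  · have htI : t ∈ Icc 0 T := ⟨ht.1, ht.2.le⟩
    have h1 : HasDerivAt (fun t => ∫ s in (0 : ℝ)..t, G s) (G t) t :=
      (hG.integral_hasStrictDerivAt 0 t).hasDerivAt
    have h2 : G t = Λ (g t) := by simp only [G, projIcc_of_mem hT htI]
    rw [h2] at h1
    refine h1.hasDerivWithinAt.congr_of_eventuallyEq ?_ (hgG t htI)
    filter_upwards [self_mem_nhdsWithin, mem_nhdsWithin_of_mem_nhds (Iio_mem_nhds ht.2)]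
      with s hs hs'
    exact hgG s ⟨ht.1.trans hs, le_of_lt hs'⟩
  · simpa using h 0 ⟨le_rfl, hT⟩

/-- The weight is finite at every frequency, so countably many cutoffs exhaust the space. -/
theorem eq_zero_of_forall_cutoff {b : L2 d}
    (h : ∀ n : ℕ, (fun κ => indicator {κ | weight P ε κ ≤ n} (fun _ => (1 : ℂ)) κ * b κ)
      =ᵐ[volume] 0) : b = 0 := by
  rw [Lp.eq_zero_iff_ae_eq_zero]
  filter_upwards [ae_all_iff.2 h] with κ hκ
  obtain ⟨n, hn⟩ := exists_nat_ge (weight P ε κ)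
  have := hκ n
  rwa [indicator_of_mem (by exact hn), one_mul] at this

theorem IsStrongSolution.eqOn (hT : 0 < T) (hp : 1 ≤ p) {ν μ : ℝ → L2 d}
    (hν : IsStrongSolution P ε T p f U μ₀ ν) (hμ : IsStrongSolution P ε T p f U μ₀ μ) :
    EqOn ν μ (Icc 0 T) := by
  obtain ⟨-, v₁, hv₁p, hv₁⟩ := hν.sobolev
  obtain ⟨-, v₂, hv₂p, hv₂⟩ := hμ.sobolev
  obtain ⟨w₁, hw₁, he₁⟩ := hν.equation
  obtain ⟨w₂, hw₂, he₂⟩ := hμ.equation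
  set η : ℝ → L2 d := v₁ - v₂
  set δ : ℝ → L2 d := ν - μ
  have hδc : ContinuousOn δ (Icc 0 T) := (continuousOn_of_continuousInDomain hν.continuous).sub
    (continuousOn_of_continuousInDomain hμ.continuous)
  have hη : IntegrableOn η (Ioo 0 T) := (hv₁p.integrable hp).sub (hv₂p.integrable hp)
  have hηc : IntegrableOn η (Ioc 0 T) := by rwa [integrableOn_Ioc_iff_integrableOn_Ioo]
  have hδ : ∀ t ∈ Icc 0 T, δ t = ∫ s in (0 : ℝ)..t, η s := by
    intro t ht
    have h0 : δ 0 = 0 := by simp [δ, hν.initial, hμ.initial]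
    have h1 : δ t = δ 0 + ∫ s in (0 : ℝ)..t, η s :=
      (hv₁.sub hv₂).eq_add_integral hT hδc hη t ht
    rwa [h0, zero_add] at h1
  -- The two source terms are identical and cancel in the difference.
  have hηδ : ∀ᵐ s ∂volume.restrict (Ioc 0 T),
      η s =ᵐ[volume] fun κ => symbol P ε κ * δ s κ := by
    rw [← restrict_Ioo_eq_restrict_Ioc]
    filter_upwards [hv₁.ae_unique hw₁, hv₂.ae_unique hw₂, he₁, he₂] with s h1 h2 h3 h4
    filter_upwards [h3, h4, Lp.coeFn_sub (v₁ s) (v₂ s), Lp.coeFn_sub (ν s) (μ s)]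
      with κ k3 k4 k5 k6
    simp only [η, δ, Pi.sub_apply] at k5 k6 ⊢
    rw [k5, k6, h1, h2, k3, k4, symbol]
    ring
  suffices h0 : ∀ t ∈ Icc 0 T, δ t = 0 from fun t ht => sub_eq_zero.1 (h0 t ht)
  intro t ht
  refine eq_zero_of_forall_cutoff (P := P) (ε := ε) fun n => ?_
  have hset : MeasurableSet {κ : Space d | weight P ε κ ≤ n} :=
    measurableSet_le (measurable_weight P ε) measurable_const
  set m : Space d → ℂ := indicator {κ | weight P ε κ ≤ n} fun _ => (1 : ℂ)
  have hm : Measurable m := measurable_const.indicator hset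
  have hm01 : ∀ κ, m κ = 1 ∧ weight P ε κ ≤ n ∨ m κ = 0 := fun κ => by
    by_cases hκ : weight P ε κ ≤ n
    · exact Or.inl ⟨indicator_of_mem (by exact hκ) _, hκ⟩
    · exact Or.inr (indicator_of_notMem (by exact hκ) _)
  obtain ⟨Q, hQ⟩ := exists_mulOp (C := 1) hm fun κ => by
    rcases hm01 κ with h | h
    · simp [h.1]
    · simp [h]
  obtain ⟨Λ, hΛ⟩ := exists_mulOp (C := n) (hm.mul (measurable_symbol P ε)) fun κ => by
    rcases hm01 κ with h | h
    · simpa [h.1] using (norm_symbol_le_weight P ε κ).trans h.2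
    · simp [h]
  -- The cutoff is idempotent: multiplying by the unbounded symbol and cutting off is the bounded
  -- `Λ` applied to what is already cut off.
  have hQη : ∀ᵐ s ∂volume.restrict (Ioc 0 T), Q (η s) = Λ (Q (δ s)) := by
    filter_upwards [hηδ] with s hs
    ext1
    filter_upwards [hs, hQ (η s), hQ (δ s), hΛ (Q (δ s))] with κ k1 k2 k3 k4
    rw [k2, k4, k1, k3, Pi.mul_apply]
    rcases hm01 κ with h | h
    · rw [h.1]; ring
    · rw [h]; ring
  have key := eqOn_zero_of_eq_integral hT.le (Λ.restrictScalars ℝ)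
    (Q.continuous.comp_continuousOn hδc) fun s hs => by
      have hsub : Ioc 0 s ⊆ Ioc 0 T := Ioc_subset_Ioc_right hs.2
      rw [Function.comp_apply, hδ s hs, intervalIntegral.integral_of_le hs.1,
        intervalIntegral.integral_of_le hs.1, ← Q.integral_comp_comm (hηc.mono_set hsub)]
      exact integral_congr_ae (ae_restrict_of_ae_restrict_of_subset hsub hQη)
  have hz : Q (δ t) = 0 := key ht
  filter_upwards [hQ (δ t), (Lp.eq_zero_iff_ae_eq_zero).1 hz] with κ k1 k2
  rw [← k1, k2]

end Uniqueness

/-! ### The Duhamel formula as a strong solution -/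

section Existence

variable {d : ℕ} {P : Fluid} {ε T : ℝ} {p : ENNReal} {f : L2 d} {U : ℝ → Space d} {μ₀ : L2 d}

theorem norm_symbol_mul_duhamelSol_le (hε : 0 ≤ ε) (hU : IntegrableOn U (Ioo 0 T)) {t : ℝ}
    (ht : t ∈ Icc 0 T) (κ : Space d) :
    ‖symbol P ε κ * duhamelSol P ε f U μ₀ t κ‖ ≤
      weight P ε κ * duhamelBound P ε T f U μ₀ κ := by
  rw [norm_mul]
  exact mul_le_mul (norm_symbol_le_weight P ε κ) (norm_duhamelSol_le hε hU ht κ)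
    (norm_nonneg _) (weight_nonneg P ε κ)

theorem aestronglyMeasurable_symbol_mul_duhamelSol (hT : 0 ≤ T) (hU : IntegrableOn U (Ioo 0 T))
    {t : ℝ} (ht : t ∈ Icc 0 T) :
    AEStronglyMeasurable (fun κ => symbol P ε κ * duhamelSol P ε f U μ₀ t κ) volume :=
  (measurable_symbol P ε).aestronglyMeasurable.mul (aestronglyMeasurable_duhamelSol hT hU ht)

theorem memLp_duhamelSol (hε : 0 ≤ ε) (hT : 0 ≤ T) (hU : IntegrableOn U (Ioo 0 T))
    (hμ₀ : μ₀ ∈ domain P ε) {t : ℝ} (ht : t ∈ Icc 0 T) :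
    MemLp (duhamelSol P ε f U μ₀ t) 2 volume :=
  memLp_of_weight_mul (memLp_weight_mul_duhamelBound (T := T) hμ₀)
    (aestronglyMeasurable_duhamelSol hT hU ht)
    fun κ => (norm_duhamelSol_le hε hU ht κ).trans (duhamelBound_le_weight_mul κ)

theorem memLp_symbol_mul_duhamelSol (hε : 0 ≤ ε) (hT : 0 ≤ T) (hU : IntegrableOn U (Ioo 0 T))
    (hμ₀ : μ₀ ∈ domain P ε) {t : ℝ} (ht : t ∈ Icc 0 T) :
    MemLp (fun κ => symbol P ε κ * duhamelSol P ε f U μ₀ t κ) 2 volume :=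
  memLp_of_weight_mul (memLp_weight_mul_duhamelBound (T := T) hμ₀)
    (aestronglyMeasurable_symbol_mul_duhamelSol hT hU ht)
    fun κ => norm_symbol_mul_duhamelSol_le hε hU ht κ

theorem continuousInDomain_duhamelSol (hε : 0 ≤ ε) (hT : 0 ≤ T) (hU : IntegrableOn U (Ioo 0 T))
    (hμ₀ : μ₀ ∈ domain P ε) :
    ContinuousInDomain P ε T fun t => toL2 (duhamelSol P ε f U μ₀ t) := by
  refine ⟨fun t ht => ?_, fun t₀ ht₀ => ?_⟩
  · refine (memLp_symbol_mul_duhamelSol (f := f) hε hT hU hμ₀ ht).ae_eq ?_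
    filter_upwards [coeFn_toL2 (memLp_duhamelSol hε hT hU hμ₀ ht)] with κ h
    rw [h]; rfl
  · have key := tendsto_integral_weight_mul_sq (l := 𝓝[Icc 0 T] t₀)
      (H := duhamelSol P ε f U μ₀) (measurable_weight P ε)
      (memLp_weight_mul_duhamelBound (T := T) (f := f) (U := U) hμ₀)
      (by filter_upwards [self_mem_nhdsWithin] with t ht
          exact aestronglyMeasurable_duhamelSol hT hU ht)
      (aestronglyMeasurable_duhamelSol hT hU ht₀)
      (by filter_upwards [self_mem_nhdsWithin] with t ht κ
          exact norm_duhamelSol_le hε hU ht κ)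
      (norm_duhamelSol_le hε hU ht₀)
      (fun κ => continuousOn_duhamelSol hε hT hU κ t₀ ht₀)
    have h2 := (Real.continuous_sqrt.tendsto 0).comp key
    rw [Real.sqrt_zero] at h2
    refine h2.congr' ?_
    filter_upwards [self_mem_nhdsWithin] with t ht
    rw [Function.comp_apply, domainNorm_eq]
    congr 1
    refine integral_congr_ae ?_
    filter_upwards [coeFn_toL2 (memLp_duhamelSol hε hT hU hμ₀ ht),
      coeFn_toL2 (memLp_duhamelSol hε hT hU hμ₀ ht₀),
      Lp.coeFn_sub (toL2 (duhamelSol P ε f U μ₀ t)) (toL2 (duhamelSol P ε f U μ₀ t₀))]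
      with κ h1 h2 h3
    rw [h3, Pi.sub_apply, h1, h2]

theorem continuousOn_toL2_symbol_mul_duhamelSol (hε : 0 ≤ ε) (hT : 0 ≤ T)
    (hU : IntegrableOn U (Ioo 0 T)) (hμ₀ : μ₀ ∈ domain P ε) :
    ContinuousOn (fun t => toL2 fun κ => symbol P ε κ * duhamelSol P ε f U μ₀ t κ) (Icc 0 T) := by
  intro t₀ ht₀
  refine tendsto_toL2 (memLp_weight_mul_duhamelBound (T := T) (f := f) (U := U) hμ₀)
    (by filter_upwards [self_mem_nhdsWithin] with t ht
        exact aestronglyMeasurable_symbol_mul_duhamelSol hT hU ht)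
    (aestronglyMeasurable_symbol_mul_duhamelSol hT hU ht₀)
    (by filter_upwards [self_mem_nhdsWithin] with t ht κ
        exact norm_symbol_mul_duhamelSol_le hε hU ht κ)
    (norm_symbol_mul_duhamelSol_le hε hU ht₀)
    (fun κ => (continuousOn_duhamelSol hε hT hU κ t₀ ht₀).const_mul _)

theorem memLp_of_continuousOn_Icc {E : Type*} [NormedAddCommGroup E] {u : ℝ → E}
    (hu : ContinuousOn u (Icc 0 T)) : MemLp u p (volume.restrict (Ioo 0 T)) := by
  obtain ⟨C, hC⟩ := isCompact_Icc.exists_bound_of_continuousOn hu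
  refine MemLp.of_bound ((hu.mono Ioo_subset_Icc_self).aestronglyMeasurable measurableSet_Ioo) C ?_
  filter_upwards [ae_restrict_mem measurableSet_Ioo] with t ht
  exact hC t (Ioo_subset_Icc_self ht)

/-- Strong measurability in $L^2$ comes from composing a continuous map of velocity and position
with a measurable function of time; the norm is at most a constant times $|U(t)|$. -/
theorem memLp_toL2_source (hT : 0 ≤ T) (hp : 1 ≤ p) (hU : MemLp U p (volume.restrict (Ioo 0 T))) :
    MemLp (fun t => toL2 (sourceAt P f (U t) (position U t))) p (volume.restrict (Ioo 0 T)) := by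
  have hm : AEStronglyMeasurable (fun t => (U t, position U t)) (volume.restrict (Ioo 0 T)) :=
    hU.aestronglyMeasurable.prodMk (aestronglyMeasurable_position hT (hU.integrable hp))
  have hm' := (continuous_toL2_sourceAt P f).comp_aestronglyMeasurable hm
  refine hU.of_le_mul (c := ‖(memLp_sourceBound P f).toLp _‖) hm' (ae_of_all _ fun t => ?_)
  rw [mul_comm]
  exact norm_toL2_le (norm_nonneg _) (memLp_sourceBound P f) (norm_sourceAt_le P f _ _)

/-- The weak time derivative of Duhamel's formula. -/
def duhamelDeriv (P : Fluid) (ε : ℝ) (f : L2 d) (U : ℝ → Space d) (μ₀ : L2 d) (t : ℝ) : L2 d :=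
  toL2 (fun κ => symbol P ε κ * duhamelSol P ε f U μ₀ t κ) -
    toL2 (sourceAt P f (U t) (position U t))

theorem coeFn_duhamelDeriv (hε : 0 ≤ ε) (hT : 0 ≤ T) (hU : IntegrableOn U (Ioo 0 T))
    (hμ₀ : μ₀ ∈ domain P ε) {t : ℝ} (ht : t ∈ Icc 0 T) :
    duhamelDeriv P ε f U μ₀ t =ᵐ[volume]
      fun κ => symbol P ε κ * duhamelSol P ε f U μ₀ t κ - source P f U t κ := by
  filter_upwards [coeFn_toL2 (memLp_symbol_mul_duhamelSol hε hT hU hμ₀ ht (f := f)),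
    coeFn_toL2 (memLp_sourceAt P f (U t) (position U t)),
    Lp.coeFn_sub (toL2 fun κ => symbol P ε κ * duhamelSol P ε f U μ₀ t κ)
      (toL2 (sourceAt P f (U t) (position U t)))] with κ h1 h2 h3
  rw [duhamelDeriv, h3, Pi.sub_apply, h1, h2, source_eq_sourceAt]

theorem memLp_duhamelDeriv (hε : 0 ≤ ε) (hT : 0 ≤ T) (hp : 1 ≤ p)
    (hU : MemLp U p (volume.restrict (Ioo 0 T))) (hμ₀ : μ₀ ∈ domain P ε) :
    MemLp (duhamelDeriv P ε f U μ₀) p (volume.restrict (Ioo 0 T)) :=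
  (memLp_of_continuousOn_Icc
    (continuousOn_toL2_symbol_mul_duhamelSol hε hT (hU.integrable hp) hμ₀)).sub
    (memLp_toL2_source hT hp hU)

/-- The vector-valued identity is evaluated at almost every frequency, where it is the scalar one;
`coeFn_integral_L2` justifies the exchange. -/
theorem hasWeakDeriv_duhamelSol (hε : 0 ≤ ε) (hT : 0 ≤ T) (hU : IntegrableOn U (Ioo 0 T))
    (hμ₀ : μ₀ ∈ domain P ε) :
    HasWeakDeriv T (fun t => toL2 (duhamelSol P ε f U μ₀ t)) (duhamelDeriv P ε f U μ₀) := by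
  set ρ : Measure ℝ := volume.restrict (Ioo 0 T)
  have hμ : LocallyIntegrableOn (fun t => toL2 (duhamelSol P ε f U μ₀ t)) (Ioo 0 T) :=
    ((continuousOn_of_continuousInDomain (continuousInDomain_duhamelSol hε hT hU hμ₀)).mono
      Ioo_subset_Icc_self).locallyIntegrableOn measurableSet_Ioo
  have hv : LocallyIntegrableOn (duhamelDeriv P ε f U μ₀) (Ioo 0 T) :=
    IntegrableOn.locallyIntegrableOn
      (memLp_one_iff_integrable.1 (memLp_duhamelDeriv hε hT le_rfl
        (memLp_one_iff_integrable.2 hU) hμ₀))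
  refine ⟨hμ, hv, fun φ hφ hc hs => ?_⟩
  have hd : Continuous (deriv φ) := hφ.continuous_deriv (by simp)
  have hds : tsupport (deriv φ) ⊆ Ioo 0 T := (tsupport_deriv_subset (𝕜 := ℝ)).trans hs
  have hφc := hφ.continuous
  obtain ⟨M₁, hM₁⟩ := hc.exists_bound_of_continuous hφc
  obtain ⟨M₂, hM₂⟩ := hc.deriv.exists_bound_of_continuous hd
  set M := max M₁ M₂
  have hM0 : 0 ≤ M := (norm_nonneg _).trans ((hM₁ 0).trans (le_max_left _ _))
  have hi1 : IntegrableOn (fun t => deriv φ t • toL2 (duhamelSol P ε f U μ₀ t)) (Ioo 0 T) :=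
    integrableOn_smul_of_tsupport_subset hd hc.deriv hds hμ
  have hi2 : IntegrableOn (fun t => φ t • duhamelDeriv P ε f U μ₀ t) (Ioo 0 T) :=
    integrableOn_smul_of_tsupport_subset hφc hc hs hv
  rw [eq_neg_iff_add_eq_zero, ← integral_add hi1 hi2]
  set H : ℝ → Space d → ℂ := fun t κ => ((deriv φ t : ℝ) : ℂ) * duhamelSol P ε f U μ₀ t κ +
      (φ t : ℂ) * (symbol P ε κ * duhamelSol P ε f U μ₀ t κ - source P f U t κ)
  have hcoe : (∫ t in Ioo 0 T, (deriv φ t • toL2 (duhamelSol P ε f U μ₀ t) +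
      φ t • duhamelDeriv P ε f U μ₀ t) : L2 d) =ᵐ[volume] fun κ => ∫ t, H t κ ∂ρ := by
    -- `M` bounds `φ` and `φ'`. The `2` counts the terms `φ' μ` and `φ l μ`, each dominated by the
    -- weighted bound; `‖U t‖` accounts for the source.
    refine coeFn_integral_L2 (a := fun t => M * (2 + ‖U t‖))
      (β := fun κ => weight P ε κ * duhamelBound P ε T f U μ₀ κ + sourceBound P f κ)
      (hi1.add hi2) ?_ ?_ ?_ ((memLp_weight_mul_duhamelBound hμ₀).add (memLp_sourceBound P f)) ?_
    · filter_upwards [ae_restrict_mem measurableSet_Ioo] with t ht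
      have ht' := Ioo_subset_Icc_self ht
      filter_upwards [coeFn_toL2 (memLp_duhamelSol hε hT hU hμ₀ ht' (f := f)),
        coeFn_duhamelDeriv hε hT hU hμ₀ ht' (f := f),
        Lp.coeFn_add (deriv φ t • toL2 (duhamelSol P ε f U μ₀ t))
          (φ t • duhamelDeriv P ε f U μ₀ t),
        Lp.coeFn_smul (deriv φ t) (toL2 (duhamelSol P ε f U μ₀ t)),
        Lp.coeFn_smul (φ t) (duhamelDeriv P ε f U μ₀ t)] with κ h1 h2 h3 h4 h5
      rw [h3, Pi.add_apply, h4, h5, Pi.smul_apply, Pi.smul_apply, h1, h2, Complex.real_smul,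
        Complex.real_smul]
    · have hsy := measurable_symbol (d := d) P ε
      have hS : AEStronglyMeasurable (fun q : ℝ × Space d => duhamelSol P ε f U μ₀ q.1 q.2)
        (ρ.prod volume) := aestronglyMeasurable_uncurry_duhamelSol hT hU
      have hsrc := aestronglyMeasurable_source P f hU.aestronglyMeasurable
        (aestronglyMeasurable_position hT hU)
      refine AEStronglyMeasurable.add (AEStronglyMeasurable.mul ?_ hS)
        (AEStronglyMeasurable.mul ?_ (AEStronglyMeasurable.sub (AEStronglyMeasurable.mul ?_ hS)
          hsrc))
      · exact Continuous.aestronglyMeasurable (by fun_prop)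
      · exact Continuous.aestronglyMeasurable (by fun_prop)
      · exact Measurable.aestronglyMeasurable (by fun_prop)
    · have h2 : Integrable (fun _ : ℝ => (2 : ℝ)) ρ := integrable_const _
      exact (h2.add hU.norm).const_mul M
    · filter_upwards [ae_restrict_mem measurableSet_Ioo] with t ht κ
      have ht' := Ioo_subset_Icc_self ht
      have k1 := (norm_duhamelSol_le hε hU ht' κ (P := P) (f := f) (μ₀ := μ₀)).trans
        (duhamelBound_le_weight_mul κ)
      have k2 := norm_symbol_mul_duhamelSol_le hε hU ht' κ (P := P) (f := f) (μ₀ := μ₀)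
      have k3 : ‖source P f U t κ‖ ≤ ‖U t‖ * sourceBound P f κ := norm_sourceAt_le P f _ _ κ
      have k4 : ‖((deriv φ t : ℝ) : ℂ)‖ ≤ M := by
        rw [Complex.norm_real]; exact (hM₂ t).trans (le_max_right _ _)
      have k5 : ‖(φ t : ℂ)‖ ≤ M := by
        rw [Complex.norm_real]; exact (hM₁ t).trans (le_max_left _ _)
      set wb := weight P ε κ * duhamelBound P ε T f U μ₀ κ
      have hwb : 0 ≤ wb := mul_nonneg (weight_nonneg P ε κ) (duhamelBound_nonneg κ)
      have hsb := sourceBound_nonneg P f κ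
      have hUt := norm_nonneg (U t)
      calc ‖H t κ‖ ≤ M * wb + M * (wb + ‖U t‖ * sourceBound P f κ) := by
            refine (norm_add_le _ _).trans (add_le_add ?_ ?_)
            · rw [norm_mul]; exact mul_le_mul k4 k1 (norm_nonneg _) hM0
            · rw [norm_mul]
              exact mul_le_mul k5 ((norm_sub_le _ _).trans (add_le_add k2 k3)) (norm_nonneg _) hM0
        _ = M * (2 * wb + ‖U t‖ * sourceBound P f κ) := by ring
        _ ≤ M * ((2 + ‖U t‖) * (wb + sourceBound P f κ)) := by
            refine mul_le_mul_of_nonneg_left ?_ hM0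
            nlinarith [mul_nonneg hUt hwb]
        _ = _ := by ring
  rw [Lp.eq_zero_iff_ae_eq_zero]
  filter_upwards [hcoe] with κ h
  rw [h]
  exact integral_deriv_mul_duhamelSol hε hT hU hφ hs κ

theorem isStrongSolution_duhamelSol (hε : 0 ≤ ε) (hT : 0 ≤ T) (hp : 1 ≤ p)
    (hU : MemLp U p (volume.restrict (Ioo 0 T))) (hμ₀ : μ₀ ∈ domain P ε) :
    IsStrongSolution P ε T p f U μ₀ fun t => toL2 (duhamelSol P ε f U μ₀ t) := by
  have hU1 : IntegrableOn U (Ioo 0 T) := hU.integrable hp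
  have hc := continuousInDomain_duhamelSol (f := f) hε hT hU1 hμ₀
  have hw := hasWeakDeriv_duhamelSol (f := f) hε hT hU1 hμ₀
  refine ⟨hc, ⟨memLp_of_continuousOn_Icc (continuousOn_of_continuousInDomain hc), _,
    memLp_duhamelDeriv hε hT hp hU hμ₀, hw⟩, ⟨_, hw, ?_⟩, ?_⟩
  · filter_upwards [ae_restrict_mem measurableSet_Ioo] with t ht
    have ht' := Ioo_subset_Icc_self ht
    filter_upwards [coeFn_toL2 (memLp_duhamelSol hε hT hU1 hμ₀ ht' (f := f)),
      coeFn_duhamelDeriv hε hT hU1 hμ₀ ht' (f := f)] with κ h1 h2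
    rw [h1, h2, symbol]
  · ext1
    filter_upwards [coeFn_toL2 (memLp_duhamelSol hε hT hU1 hμ₀ (f := f) ⟨le_rfl, hT⟩)] with κ h
    rw [h]
    simp [duhamelSol, duhamelAmplitude]

theorem duhamel_duhamelSol (hε : 0 ≤ ε) (hT : 0 ≤ T) (hU : IntegrableOn U (Ioo 0 T))
    (hμ₀ : μ₀ ∈ domain P ε) :
    Duhamel P ε T f U μ₀ fun t => toL2 (duhamelSol P ε f U μ₀ t) := by
  intro t ht
  filter_upwards [coeFn_toL2 (memLp_duhamelSol hε hT hU hμ₀ ht (f := f))] with κ h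
  have heq : ∀ τ : ℝ, Complex.exp (Complex.I * omegaEps P ε κ * ((t - τ : ℝ) : ℂ)) *
      source P f U τ κ = Complex.exp (symbol P ε κ * (t : ℂ)) * pulledSource P ε f U τ κ := by
    intro τ
    rw [pulledSource, ← mul_assoc, ← Complex.exp_add, symbol]
    congr 2
    push_cast; ring
  simp only [heq]
  have hi : IntervalIntegrable (fun τ => pulledSource P ε f U τ κ) volume 0 t := by
    rw [intervalIntegrable_iff_integrableOn_Ioo_of_le ht.1]
    exact (integrableOn_pulledSource hε hT hU κ).mono_set (Ioo_subset_Ioo_right ht.2)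
  refine ⟨hi.const_mul _, ?_⟩
  rw [h, intervalIntegral.integral_const_mul, duhamelSol, duhamelAmplitude, symbol]
  ring

end Existence

end DeadWater

end

theorem mainTheorem1 (d : ℕ) (hd : 1 ≤ d) (P : DeadWater.Fluid) (ε T : ℝ) (hε : 0 ≤ ε) (hT : 0 < T)
    (p : ENNReal) (hp : 1 ≤ p) (f : DeadWater.L2 d) (U : ℝ → DeadWater.Space d)
    (hU : MemLp U p (volume.restrict (Ioo 0 T)))
    (μ₀ : DeadWater.L2 d) (hμ₀ : μ₀ ∈ DeadWater.domain P ε) :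
    ∃ μ : ℝ → DeadWater.L2 d,
      DeadWater.IsStrongSolution P ε T p f U μ₀ μ ∧
      (∀ ν : ℝ → DeadWater.L2 d,
        DeadWater.IsStrongSolution P ε T p f U μ₀ ν → EqOn ν μ (Icc 0 T)) ∧
      DeadWater.Duhamel P ε T f U μ₀ μ := by
  have hsol := DeadWater.isStrongSolution_duhamelSol (f := f) hε hT.le hp hU hμ₀
  exact ⟨_, hsol, fun ν hν => hν.eqOn hT hp hsol,
    DeadWater.duhamel_duhamelSol hε hT.le (hU.integrable hp) hμ₀⟩
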